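/- Let $\mathbb{D}=\{z\in\mathbb{C}:|z|<1\}$, let $n\ge 2$ be an integer and let $F_n(z)=z-\frac{1}{n^2}z^n$. A domain in $\mathbb{C}$ is called convex in the horizontal direction if its intersection with every line parallel to the real axis is connected (or empty). Then $F_n$ is analytic and univalent on $\mathbb{D}$, and $F_n(\mathbb{D})$ is a domain convex in the horizontal direction. Moreover, the horizontal shear of $F_n$ with dilatation $\omega(z)=z^n$ is $f_n=h_n+\overline{g_n}$, where $$h_n(z)=z\,{}_2F_1\!\left(1,\tfrac1n;\tfrac1n+1;z^n\right)+\frac{\log(z^n-1)}{n^2}-\frac{\pi i}{n^2},$$ $$g_n(z)=z\,{}_2F_1\!\left(1,\tfrac1n;\tfrac{n+1}{n};z^n\right)-z+\frac{\log(z^n-1)+z^n}{n^2}-\frac{\pi i}{n^2};$$ here ${}_2F_1$ is the Gauss hypergeometric series and $\log$ is the branch of the logarithm on $\mathbb{C}\setminus[0,\infty)$ with imaginary part in $(0,2\pi)$, so that $\log(-1)=\pi i$. That is, $h_n$ and $g_n$ are analytic on $\mathbb{D}$ with $h_n(0)=g_n(0)=0$, $h_n-g_n=F_n$, $h_n'\neq0$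 and $g_n'/h_n'=z^n$ on $\mathbb{D}$, and they are the only functions on $\mathbb{D}$ with these properties. The map $f_n$ belongs to $S_H^0$, i.e. it is harmonic and univalent on $\mathbb{D}$ and of the form $h+\overline g$ with $h,g$ analytic on $\mathbb D$, $h(0)=g(0)=0$, $h'(0)=1$, $g'(0)=0$; and $f_n(\mathbb{D})$ is a domain convex in the horizontal direction. If $n=2m$ is even, then $f_n$ lifts to a minimal graph: there is a smooth function $\varphi$ on $f_n(\mathbb{D})$ whose graph $\{(u,v,\varphi(u,v)):u+iv\in f_n(\mathbb{D})\}$ has zero mean curvature at every point and is parametrized over $z\in\mathbb{D}$, isothermally and with projection $f_n$ to the base plane, by $(x_1,x_2,x_3)$, where $x_1=\operatorname{Re}\{h_n(z)+g_n(z)\}$, $x_2=\operatorname{Im}\{h_n(z)-g_n(z)\}$ and $$x_3=2\operatorname{Im}\left\{\int_0^z\zeta^m h_n'(\zeta)\,d\zeta\right\}=2\operatorname{Im}\left\{\frac12\left[z\,{}_2F_1\!\left(1,\tfrac1m;\tfrac1m+1;z^m\right)-z\,{}_2F_1\!\left(1,\tfrac1m;\tfrac1m+1;-z^m\right)\right]-\frac{1}{2m}\cdot\frac{\operatorname{atanh}(z^m)-z^m}{m}\right\},$$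 with $\operatorname{atanh}(w)=\frac12\left(\operatorname{Log}(1+w)-\operatorname{Log}(1-w)\right)$ and $\operatorname{Log}$ the principal logarithm. -/

import Mathlib

open scoped ContDiff ComplexConjugate Matrix

noncomputable section

namespace EpicycloidShear

/-- The open unit disk. -/
abbrev unitDisk : Set ℂ := Metric.ball 0 1

/-! ### Planar harmonic mappings and the shear construction -/

/-- A domain (open connected set) that has connected (possibly empty) intersection with every
horizontal line. -/
def IsCHDDomain (Ω : Set ℂ) : Prop :=
  IsOpen Ω ∧ IsConnected Ω ∧ ∀ c : ℝ, IsPreconnected (Ω ∩ {w : ℂ | w.im = c})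

/-- Analytic and injective on the unit disk. -/
def IsConformalUnivalent (F : ℂ → ℂ) : Prop :=
  DifferentiableOn ℂ F unitDisk ∧ Set.InjOn F unitDisk

/-- `h + conj g`. -/
def harmonicMap (h g : ℂ → ℂ) (z : ℂ) : ℂ := h z + conj (g z)

/-- The class `S_H^0`: harmonic univalent maps `f = h + conj g` of the unit disk, with `h`, `g`
analytic, `h 0 = g 0 = 0`, `h' 0 = 1`, `g' 0 = 0`. -/
def SH0 : Set (ℂ → ℂ) :=
  {f | InnerProductSpace.HarmonicOnNhd f unitDisk ∧ Set.InjOn f unitDisk ∧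
    ∃ h g : ℂ → ℂ, DifferentiableOn ℂ h unitDisk ∧ DifferentiableOn ℂ g unitDisk ∧
      Set.EqOn f (harmonicMap h g) unitDisk ∧
      h 0 = 0 ∧ g 0 = 0 ∧ deriv h 0 = 1 ∧ deriv g 0 = 0}

/-- `h` and `g` are the analytic and co-analytic parts, normalized at `0`, of the horizontal shear
`h + conj g` of `F` with dilatation `dil`, i.e. `h - g = F` and `g' / h' = dil` on the unit disk. -/
structure IsHorizontalShear (F dil h g : ℂ → ℂ) : Prop where
  differentiableOn_h : DifferentiableOn ℂ h unitDisk
  differentiableOn_g : DifferentiableOn ℂ g unitDisk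
  map_zero_h : h 0 = 0
  map_zero_g : g 0 = 0
  sub_eq : ∀ z ∈ unitDisk, h z - g z = F z
  deriv_ne_zero : ∀ z ∈ unitDisk, deriv h z ≠ 0
  dilatation_eq : ∀ z ∈ unitDisk, deriv g z / deriv h z = dil z

/-! ### Surfaces in `ℝ³` parametrized by `z = x + i y`, and their mean curvature -/

/-- Partial derivative in `x`. -/
def partialX (X : ℂ → Fin 3 → ℝ) (p : ℂ) : Fin 3 → ℝ := fderiv ℝ X p 1

/-- Partial derivative in `y`. -/
def partialY (X : ℂ → Fin 3 → ℝ) (p : ℂ) : Fin 3 → ℝ := fderiv ℝ X p Complex.I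

/-- The unit normal `X_x × X_y / |X_x × X_y|`. -/
def unitNormal (X : ℂ → Fin 3 → ℝ) (p : ℂ) : Fin 3 → ℝ :=
  let v := crossProduct (partialX X p) (partialY X p)
  (√(v ⬝ᵥ v))⁻¹ • v

/-- Mean curvature `(e G - 2 f F + g E) / (2 (E G - F²))`, where `E, F, G` and `e, f, g` are the
coefficients of the first and second fundamental forms. -/
def meanCurvature (X : ℂ → Fin 3 → ℝ) (p : ℂ) : ℝ :=
  let E := partialX X p ⬝ᵥ partialX X p
  let F := partialX X p ⬝ᵥ partialY X p
  let G := partialY X p ⬝ᵥ partialY X p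
  let e := unitNormal X p ⬝ᵥ partialX (partialX X) p
  let f := unitNormal X p ⬝ᵥ partialX (partialY X) p
  let g := unitNormal X p ⬝ᵥ partialY (partialY X) p
  (e * G - 2 * f * F + g * E) / (2 * (E * G - F ^ 2))

/-- The surface `(u, v, φ(u, v))`, where `w = u + i v`. -/
def graphMap (φ : ℂ → ℝ) (w : ℂ) : Fin 3 → ℝ := ![w.re, w.im, φ w]

/-- The graph of `φ` over the open set `Ω` is a smooth surface with zero mean curvature. -/
def IsMinimalGraph (Ω : Set ℂ) (φ : ℂ → ℝ) : Prop :=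
  IsOpen Ω ∧ ContDiffOn ℝ ∞ φ Ω ∧ ∀ w ∈ Ω, meanCurvature (graphMap φ) w = 0

/-- `X` is a smooth isothermal (conformal) parametrization on the unit disk. -/
def IsIsothermal (X : ℂ → Fin 3 → ℝ) : Prop :=
  ContDiffOn ℝ ∞ X unitDisk ∧ ∀ z ∈ unitDisk,
    0 < partialX X z ⬝ᵥ partialX X z ∧
    partialX X z ⬝ᵥ partialX X z = partialY X z ⬝ᵥ partialY X z ∧
    partialX X z ⬝ᵥ partialY X z = 0

/-- `f` lifts to the minimal graph parametrized by `X`: `X` is an isothermal parametrization on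
the unit disk of a minimal graph over the image of `f`, and its projection to the base plane
is `f`. -/
def LiftsToMinimalGraph (f : ℂ → ℂ) (X : ℂ → Fin 3 → ℝ) : Prop :=
  IsIsothermal X ∧ ∃ φ : ℂ → ℝ, IsMinimalGraph (f '' unitDisk) φ ∧
    ∀ z ∈ unitDisk, X z = graphMap φ (f z)

/-! ### The explicit functions -/

/-- The branch of the logarithm on `ℂ ∖ [0, ∞)` with imaginary part in `(0, 2π)`. It is analytic
there, and its value at `-1` is `π i`. -/
def logBranch (w : ℂ) : ℂ := Complex.log (-w) + Real.pi * Complex.I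

/-- The inverse hyperbolic tangent, principal branch. -/
def atanh (w : ℂ) : ℂ := (Complex.log (1 + w) - Complex.log (1 - w)) / 2

/-- `F_n(z) = z - z^n / n²`. -/
def F (n : ℕ) (z : ℂ) : ℂ := z - 1 / (n : ℂ) ^ 2 * z ^ n

/-- The analytic part of the shear. -/
def h (n : ℕ) (z : ℂ) : ℂ :=
  z * ₂F₁ (1 : ℂ) (1 / (n : ℂ)) (1 / (n : ℂ) + 1) (z ^ n)
    + logBranch (z ^ n - 1) / (n : ℂ) ^ 2 - Real.pi * Complex.I / (n : ℂ) ^ 2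

/-- The co-analytic part of the shear. -/
def g (n : ℕ) (z : ℂ) : ℂ :=
  z * ₂F₁ (1 : ℂ) (1 / (n : ℂ)) (((n : ℂ) + 1) / (n : ℂ)) (z ^ n) - z
    + (logBranch (z ^ n - 1) + z ^ n) / (n : ℂ) ^ 2 - Real.pi * Complex.I / (n : ℂ) ^ 2

/-- `f_n = h_n + conj g_n`. -/
def f (n : ℕ) : ℂ → ℂ := harmonicMap (h n) (g n)

/-- The third coordinate of the lift of `f_{2m}`. -/
def x₃ (m : ℕ) (z : ℂ) : ℝ :=
  2 * (1 / 2 * (z * ₂F₁ (1 : ℂ) (1 / (m : ℂ)) (1 / (m : ℂ) + 1) (z ^ m)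
        - z * ₂F₁ (1 : ℂ) (1 / (m : ℂ)) (1 / (m : ℂ) + 1) (-z ^ m))
      - 1 / (2 * (m : ℂ)) * ((atanh (z ^ m) - z ^ m) / (m : ℂ))).im

/-- The lift `(Re (h + g), Im (h - g), x₃)` of `f_{2m}`. -/
def lift (m : ℕ) (z : ℂ) : Fin 3 → ℝ :=
  ![(h (2 * m) z + g (2 * m) z).re, (h (2 * m) z - g (2 * m) z).im, x₃ m z]

end EpicycloidShear

end

noncomputable section

namespace EpicycloidShear

/-! ### The hypergeometric primitive of `1 / (1 - c z ^ n)` -/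

/-! The explicit formulas reduce to one primitive: `z * ₂F₁ 1 (1/n) (1/n+1) (c * z ^ n)` is the
series `∑ c ^ k z ^ (nk+1) / (nk+1)`, with derivative `1 / (1 - c z ^ n)`. Hence `h' = (1 - z ^
(n-1) / n) / (1 - z ^ n)`; since `h - g = F` is an algebraic identity, `g' = z ^ n h'` follows.
Uniqueness holds because `h - g = F` and `g' = ω h'` force `h' (1 - ω) = F'`.

`F n` is injective because `‖z ^ n - w ^ n‖ ≤ n ‖z - w‖`, whereas equal values would require `n² ‖z
- w‖`. Its image is even convex: `|z F''| ≤ |F'|` makes `|F⁻¹|²` convex along segments of the image,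
and a continuity argument over pairs of points shows that no segment leaves the image
(`convex_image_unitDisk`).

The shear `f = h + conj g` has the same imaginary part as `F`. Along the `F`-preimage of a
horizontal segment, `Re f` is strictly monotone, its derivative being a nonzero real multiple of `Re
((1 + ω) / (1 - ω)) > 0`. This gives univalence, and `f ∘ F⁻¹` carries horizontal slices onto
horizontal slices.

For `n = 2m` the dilatation is the square of `ζ = z ^ m`. With `K' = ζ h'`, the Weierstrass–Enneper
lift is isothermal with harmonic coordinates. Its height as a function on the base is `φ = 2 Im K ∘
f⁻¹`. Harmonicity of `φ ∘ f`, together with the slopes of `φ` expressed through `ζ`, is the minimal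
surface equation (`minimal_surface_equation`). -/

/-- The factor `(1)_k` cancels `k!`, and the quotient `(a)_k / (a+1)_k` telescopes. -/
theorem ordinaryHypergeometricCoefficient_one_add_one {a : ℂ} (ha : ∀ k : ℕ, a + k ≠ 0) (k : ℕ) :
    ordinaryHypergeometricCoefficient 1 a (a + 1) k = a / (a + k) := by
  have hshift : (ascPochhammer ℂ k).eval a * (a + k) = a * (ascPochhammer ℂ k).eval (a + 1) := by
    rw [← ascPochhammer_succ_eval, ascPochhammer_succ_left]
    simp
  have hne : (ascPochhammer ℂ k).eval (a + 1) ≠ 0 := by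
    rw [Ne, ascPochhammer_eval_eq_zero_iff]
    rintro ⟨j, -, hj⟩
    apply ha (j + 1)
    push_cast
    linear_combination hj
  have hfact : (k.factorial : ℂ) ≠ 0 := by exact_mod_cast k.factorial_ne_zero
  have hk := ha k
  rw [ordinaryHypergeometricCoefficient, ascPochhammer_eval_one]
  field_simp
  linear_combination hshift

theorem one_div_natCast_add_ne_zero {n : ℕ} (hn : n ≠ 0) (k : ℕ) : (1 / (n : ℂ)) + k ≠ 0 := by
  have : (0 : ℝ) < 1 / (n : ℝ) + k := by
    have : (0 : ℝ) < n := by exact_mod_cast Nat.pos_of_ne_zero hn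
    positivity
  have hcast : ((1 / (n : ℝ) + k : ℝ) : ℂ) ≠ 0 := Complex.ofReal_ne_zero.2 this.ne'
  simpa using hcast

theorem mul_hypergeometric_eq_tsum {n : ℕ} (hn : n ≠ 0) (c z : ℂ) :
    z * ₂F₁ (1 : ℂ) (1 / (n : ℂ)) (1 / (n : ℂ) + 1) (c * z ^ n) =
      ∑' k : ℕ, c ^ k * z ^ (n * k + 1) / ((n * k + 1 : ℕ) : ℂ) := by
  rw [ordinaryHypergeometric_eq_tsum, ← tsum_mul_left]
  refine tsum_congr fun k => ?_
  have hcoeff := ordinaryHypergeometricCoefficient_one_add_one (one_div_natCast_add_ne_zero hn) k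
  have hn' : (n : ℂ) ≠ 0 := by exact_mod_cast hn
  have hk : ((n * k + 1 : ℕ) : ℂ) ≠ 0 := by exact_mod_cast (n * k).succ_ne_zero
  rw [ordinaryHypergeometricCoefficient] at hcoeff
  rw [hcoeff, smul_eq_mul]
  have hk' := one_div_natCast_add_ne_zero hn k
  have : (1 / (n : ℂ)) / (1 / (n : ℂ) + k) = 1 / ((n * k + 1 : ℕ) : ℂ) := by
    rw [div_eq_div_iff hk' hk]
    push_cast
    field_simp
    ring
  rw [this]
  ring

/-- Termwise differentiation turns the series into a geometric one. The parameter `c` lets the case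
`c = 1` serve `h` and the cases `c = ±1` serve the third coordinate. -/
theorem hasDerivAt_mul_hypergeometric {n : ℕ} (hn : n ≠ 0) {c : ℂ} (hc : ‖c‖ ≤ 1) {z : ℂ}
    (hz : ‖z‖ < 1) :
    HasDerivAt (fun z : ℂ => z * ₂F₁ (1 : ℂ) (1 / (n : ℂ)) (1 / (n : ℂ) + 1) (c * z ^ n))
      (1 / (1 - c * z ^ n)) z := by
  simp_rw [mul_hypergeometric_eq_tsum hn]
  obtain ⟨r, hzr, hr⟩ := exists_between hz
  have hr0 : 0 ≤ r := (norm_nonneg z).trans hzr.le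
  have hdiff : ∀ k : ℕ, DifferentiableOn ℂ
      (fun z : ℂ => c ^ k * z ^ (n * k + 1) / ((n * k + 1 : ℕ) : ℂ)) (Metric.ball 0 r) :=
    fun k => by fun_prop
  -- Weierstrass test on a slightly smaller disk: `n * k + 1 ≥ k` and a denominator at least `1`
  -- give the majorant `r ^ k`.
  have hbound : ∀ (k : ℕ) (w : ℂ), w ∈ Metric.ball (0 : ℂ) r →
      ‖c ^ k * w ^ (n * k + 1) / ((n * k + 1 : ℕ) : ℂ)‖ ≤ r ^ k := by
    intro k w hw
    rw [mem_ball_zero_iff] at hw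
    rw [norm_div, norm_mul, norm_pow, norm_pow, Complex.norm_natCast]
    have h1 : (1 : ℝ) ≤ ((n * k + 1 : ℕ) : ℝ) := by exact_mod_cast (n * k).succ_pos
    have h2 : ‖c‖ ^ k * ‖w‖ ^ (n * k + 1) ≤ 1 * r ^ k := by
      gcongr
      · exact pow_le_one₀ (norm_nonneg _) hc
      · calc ‖w‖ ^ (n * k + 1) ≤ ‖w‖ ^ k :=
              pow_le_pow_of_le_one (norm_nonneg _) (hw.le.trans hr.le)
                (by nlinarith [Nat.pos_of_ne_zero hn])
          _ ≤ r ^ k := by gcongr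
    rw [one_mul] at h2
    exact (div_le_self (by positivity) h1).trans h2
  have hsum := summable_geometric_of_lt_one hr0 hr
  have hz' : z ∈ Metric.ball (0 : ℂ) r := by rwa [mem_ball_zero_iff]
  have hderiv := Complex.hasSum_deriv_of_summable_norm hsum hdiff Metric.isOpen_ball hbound hz'
  have hterm : ∀ k : ℕ, deriv (fun z : ℂ => c ^ k * z ^ (n * k + 1) / ((n * k + 1 : ℕ) : ℂ)) z
      = (c * z ^ n) ^ k := by
    intro k
    have hk : ((n * k + 1 : ℕ) : ℂ) ≠ 0 := by exact_mod_cast (n * k).succ_ne_zero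
    have := (((hasDerivAt_pow (n * k + 1) z).const_mul (c ^ k)).div_const ((n * k + 1 : ℕ) : ℂ))
    rw [this.deriv, Nat.add_sub_cancel, mul_pow, ← pow_mul]
    field_simp
  simp_rw [hterm] at hderiv
  have hlt : ‖c * z ^ n‖ < 1 := by
    rw [norm_mul, norm_pow]
    exact (mul_le_of_le_one_left (by positivity) hc).trans_lt
      (pow_lt_one₀ (norm_nonneg _) hz hn)
  rw [one_div, ← hderiv.unique (hasSum_geometric_of_norm_lt_one hlt)]
  exact ((Complex.differentiableOn_tsum_of_summable_norm hsum hdiff Metric.isOpen_ball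
    hbound).differentiableAt (Metric.isOpen_ball.mem_nhds hz')).hasDerivAt

/-! ### Derivatives of the explicit functions -/

theorem norm_pow_lt_one {n : ℕ} (hn : n ≠ 0) {z : ℂ} (hz : z ∈ unitDisk) : ‖z ^ n‖ < 1 := by
  rw [norm_pow]
  exact pow_lt_one₀ (norm_nonneg _) (mem_ball_zero_iff.1 hz) hn

theorem one_sub_ne_zero_of_norm_lt_one {w : ℂ} (hw : ‖w‖ < 1) : 1 - w ≠ 0 := by
  intro h
  rw [← sub_eq_zero.1 h, norm_one] at hw
  exact lt_irrefl _ hw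

theorem one_sub_mem_slitPlane {w : ℂ} (hw : ‖w‖ < 1) : 1 - w ∈ Complex.slitPlane := by
  left
  have := (Complex.abs_re_le_norm w).trans_lt hw
  simp only [Complex.sub_re, Complex.one_re]
  linarith [(abs_lt.1 this).2]

theorem hasDerivAt_log_one_sub_mul_pow {n : ℕ} (hn : n ≠ 0) {c : ℂ} (hc : ‖c‖ ≤ 1) {z : ℂ}
    (hz : z ∈ unitDisk) :
    HasDerivAt (fun z : ℂ => Complex.log (1 - c * z ^ n))
      (-(c * (n * z ^ (n - 1))) / (1 - c * z ^ n)) z := by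
  have hlt : ‖c * z ^ n‖ < 1 := by
    rw [norm_mul]
    exact (mul_le_of_le_one_left (norm_nonneg _) hc).trans_lt (norm_pow_lt_one hn hz)
  exact (((hasDerivAt_pow n z).const_mul c).const_sub 1).clog (one_sub_mem_slitPlane hlt)

theorem hasDerivAt_F (n : ℕ) (z : ℂ) : HasDerivAt (F n) (1 - z ^ (n - 1) / n) z := by
  have := (hasDerivAt_id z).sub ((hasDerivAt_pow n z).const_mul (1 / (n : ℂ) ^ 2))
  refine this.congr_deriv ?_
  rcases eq_or_ne n 0 with rfl | hn
  · simp
  · have hn' : (n : ℂ) ≠ 0 := by exact_mod_cast hn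
    field_simp

/-- The branch satisfies `logBranch (z ^ n - 1) = log (1 - z ^ n) + π i`, so the subtracted constant
leaves a principal logarithm, whose argument lies in the slit plane for `z` in the disk. The factors
`1 *` match the derivative lemmas at `c = 1`. -/
theorem h_eq (n : ℕ) (z : ℂ) :
    h n z = z * ₂F₁ (1 : ℂ) (1 / (n : ℂ)) (1 / (n : ℂ) + 1) (1 * z ^ n)
      + Complex.log (1 - 1 * z ^ n) / (n : ℂ) ^ 2 := by
  rw [h, logBranch, neg_sub, one_mul]
  ring

theorem hasDerivAt_h {n : ℕ} (hn : n ≠ 0) {z : ℂ} (hz : z ∈ unitDisk) :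
    HasDerivAt (h n) ((1 - z ^ (n - 1) / n) / (1 - z ^ n)) z := by
  rw [funext (h_eq n)]
  refine ((hasDerivAt_mul_hypergeometric hn norm_one.le (mem_ball_zero_iff.1 hz)).add
    ((hasDerivAt_log_one_sub_mul_pow hn norm_one.le hz).div_const ((n : ℂ) ^ 2))).congr_deriv ?_
  have hn' : (n : ℂ) ≠ 0 := by exact_mod_cast hn
  have := one_sub_ne_zero_of_norm_lt_one (norm_pow_lt_one hn hz)
  rw [one_mul]
  field_simp
  ring

theorem h_sub_g {n : ℕ} (hn : n ≠ 0) (z : ℂ) : h n z - g n z = F n z := by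
  have hn' : (n : ℂ) ≠ 0 := by exact_mod_cast hn
  have : ((n : ℂ) + 1) / n = 1 / n + 1 := by field_simp; ring
  rw [h, g, F, this]
  ring

theorem hasDerivAt_g {n : ℕ} (hn : n ≠ 0) {z : ℂ} (hz : z ∈ unitDisk) :
    HasDerivAt (g n) (z ^ n * ((1 - z ^ (n - 1) / n) / (1 - z ^ n))) z := by
  have heq : g n = fun z => h n z - F n z := funext fun z => by rw [← h_sub_g hn]; ring
  rw [heq]
  refine ((hasDerivAt_h hn hz).sub (hasDerivAt_F n z)).congr_deriv ?_
  have := one_sub_ne_zero_of_norm_lt_one (norm_pow_lt_one hn hz)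
  field_simp
  ring

theorem one_sub_pow_div_ne_zero {n : ℕ} (hn : 2 ≤ n) {z : ℂ} (hz : z ∈ unitDisk) :
    1 - z ^ (n - 1) / n ≠ 0 := by
  apply one_sub_ne_zero_of_norm_lt_one
  rw [norm_div, Complex.norm_natCast]
  have h1 : (1 : ℝ) ≤ n := by exact_mod_cast (by omega : 1 ≤ n)
  exact (div_le_self (norm_nonneg _) h1).trans_lt (norm_pow_lt_one (by omega) hz)

theorem h_zero {n : ℕ} (hn : n ≠ 0) : h n 0 = 0 := by simp [h_eq, hn]

theorem g_zero {n : ℕ} (hn : n ≠ 0) : g n 0 = 0 := by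
  have := h_sub_g hn 0
  rw [h_zero hn] at this
  simpa [F, hn] using this

/-! ### The shear of `F n` -/

theorem isHorizontalShear {n : ℕ} (hn : 2 ≤ n) :
    IsHorizontalShear (F n) (fun z => z ^ n) (h n) (g n) := by
  have hn0 : n ≠ 0 := by omega
  have hne : ∀ z ∈ unitDisk, (1 - z ^ (n - 1) / n) / (1 - z ^ n) ≠ 0 := fun z hz =>
    div_ne_zero (one_sub_pow_div_ne_zero hn hz)
      (one_sub_ne_zero_of_norm_lt_one (norm_pow_lt_one hn0 hz))
  refine ⟨fun z hz => (hasDerivAt_h hn0 hz).differentiableAt.differentiableWithinAt,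
    fun z hz => (hasDerivAt_g hn0 hz).differentiableAt.differentiableWithinAt,
    h_zero hn0, g_zero hn0, fun z _ => h_sub_g hn0 z, fun z hz => ?_, fun z hz => ?_⟩
  · rw [(hasDerivAt_h hn0 hz).deriv]
    exact hne z hz
  · rw [(hasDerivAt_h hn0 hz).deriv, (hasDerivAt_g hn0 hz).deriv, mul_div_assoc,
      div_self (hne z hz), mul_one]

/-- Substitute `g' = ω h'` into `h' - g' = F'`. This determines `h'` wherever `ω ≠ 1`. -/
theorem IsHorizontalShear.deriv_mul_one_sub {F dil h g : ℂ → ℂ} (H : IsHorizontalShear F dil h g)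
    {z : ℂ} (hz : z ∈ unitDisk) : deriv h z * (1 - dil z) = deriv F z := by
  have hnhds := Metric.isOpen_ball.mem_nhds hz
  have hh := (H.differentiableOn_h.differentiableAt hnhds).hasDerivAt
  have hg := (H.differentiableOn_g.differentiableAt hnhds).hasDerivAt
  have hF : HasDerivAt F (deriv h z - deriv g z) z :=
    (hh.sub hg).congr_of_eventuallyEq
      (Filter.eventually_of_mem hnhds fun w hw => (H.sub_eq w hw).symm)
  have hdil := (div_eq_iff (H.deriv_ne_zero z hz)).1 (H.dilatation_eq z hz)
  rw [hF.deriv, hdil]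
  ring

theorem IsHorizontalShear.unique {F dil h g h' g' : ℂ → ℂ} (H : IsHorizontalShear F dil h g)
    (H' : IsHorizontalShear F dil h' g') (hdil : ∀ z ∈ unitDisk, dil z ≠ 1) :
    Set.EqOn h h' unitDisk ∧ Set.EqOn g g' unitDisk := by
  have hEq : Set.EqOn h h' unitDisk := by
    refine Metric.isOpen_ball.eqOn_of_deriv_eq (convex_ball (0 : ℂ) 1).isPreconnected
      H.differentiableOn_h H'.differentiableOn_h (fun z hz => ?_)
      (Metric.mem_ball_self one_pos) (H.map_zero_h.trans H'.map_zero_h.symm)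
    exact mul_right_cancel₀ (sub_ne_zero.2 (hdil z hz).symm)
      ((H.deriv_mul_one_sub hz).trans (H'.deriv_mul_one_sub hz).symm)
  refine ⟨hEq, fun z hz => ?_⟩
  have h1 := H.sub_eq z hz
  have h2 := H'.sub_eq z hz
  have h3 := hEq hz
  linear_combination h3 - h1 + h2

/-! ### The third coordinate -/

/-- The primitive of `z ^ m * h' z` that vanishes at `0`, for `h` the analytic part of the shear of
`F (2 * m)`. -/
def liftPrimitive (m : ℕ) (z : ℂ) : ℂ :=
  1 / 2 * (z * ₂F₁ (1 : ℂ) (1 / (m : ℂ)) (1 / (m : ℂ) + 1) (z ^ m)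
        - z * ₂F₁ (1 : ℂ) (1 / (m : ℂ)) (1 / (m : ℂ) + 1) (-z ^ m))
      - 1 / (2 * (m : ℂ)) * ((atanh (z ^ m) - z ^ m) / (m : ℂ))

theorem x₃_eq (m : ℕ) (z : ℂ) : x₃ m z = 2 * (liftPrimitive m z).im := rfl

/-- With `ζ = z ^ m`, the hypergeometric terms contribute `(1/(1-ζ) - 1/(1+ζ)) / 2 = ζ / (1-ζ²)`.
The `atanh` term contributes `-z ^ (m-1) ζ² / (2m (1-ζ²))`. -/
theorem hasDerivAt_liftPrimitive {m : ℕ} (hm : m ≠ 0) {z : ℂ} (hz : z ∈ unitDisk) :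
    HasDerivAt (liftPrimitive m)
      (z ^ m * ((1 - z ^ (2 * m - 1) / (2 * m : ℕ)) / (1 - z ^ (2 * m)))) z := by
  have heq : liftPrimitive m = fun z : ℂ =>
      1 / 2 * (z * ₂F₁ (1 : ℂ) (1 / (m : ℂ)) (1 / (m : ℂ) + 1) (1 * z ^ m)
        - z * ₂F₁ (1 : ℂ) (1 / (m : ℂ)) (1 / (m : ℂ) + 1) (-1 * z ^ m))
      - 1 / (2 * (m : ℂ)) * (((Complex.log (1 - -1 * z ^ m) - Complex.log (1 - 1 * z ^ m)) / 2
        - z ^ m) / (m : ℂ)) := by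
    funext z
    simp [liftPrimitive, atanh]
  have hneg : ‖(-1 : ℂ)‖ ≤ 1 := by simp
  have hz' := mem_ball_zero_iff.1 hz
  rw [heq]
  refine ((((hasDerivAt_mul_hypergeometric hm norm_one.le hz').sub
    (hasDerivAt_mul_hypergeometric hm hneg hz')).const_mul (1 / 2)).sub
    ((((((hasDerivAt_log_one_sub_mul_pow hm hneg hz).sub
      (hasDerivAt_log_one_sub_mul_pow hm norm_one.le hz)).div_const 2).sub
      (hasDerivAt_pow m z)).div_const (m : ℂ)).const_mul (1 / (2 * (m : ℂ))))).congr_deriv ?_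
  have hm' : (m : ℂ) ≠ 0 := by exact_mod_cast hm
  have hlt := norm_pow_lt_one hm hz
  have h1 : 1 - z ^ m ≠ 0 := one_sub_ne_zero_of_norm_lt_one hlt
  have h2 : 1 + z ^ m ≠ 0 := by
    have := one_sub_ne_zero_of_norm_lt_one (w := -z ^ m) (by rwa [norm_neg])
    rwa [sub_neg_eq_add] at this
  have hpow : z ^ (2 * m - 1) = z ^ m * z ^ (m - 1) := by
    rw [← pow_add]; congr 1; omega
  have hsq : z ^ (2 * m) = z ^ m * z ^ m := by rw [two_mul, pow_add]
  have h3 : 1 - z ^ m * z ^ m ≠ 0 := by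
    rw [show 1 - z ^ m * z ^ m = (1 - z ^ m) * (1 + z ^ m) by ring]
    exact mul_ne_zero h1 h2
  rw [hpow, hsq]
  generalize z ^ m = ζ at *
  generalize z ^ (m - 1) = ξ at *
  rw [show (1 : ℂ) - -1 * ζ = 1 + ζ by ring, one_mul,
    show 1 - ζ * ζ = (1 - ζ) * (1 + ζ) by ring]
  push_cast
  field_simp
  ring

theorem liftPrimitive_zero {m : ℕ} (hm : m ≠ 0) : liftPrimitive m 0 = 0 := by
  simp [liftPrimitive, atanh, hm]

/-- Fundamental theorem of calculus on the radius from `0` to `z`; the trailing factor `z` is the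
derivative of `t ↦ t z`. -/
theorem integral_pow_mul_deriv_h {m : ℕ} (hm : m ≠ 0) {z : ℂ} (hz : z ∈ unitDisk) :
    ∫ t in (0 : ℝ)..1, ((t : ℂ) * z) ^ m * deriv (h (2 * m)) ((t : ℂ) * z) * z =
      liftPrimitive m z := by
  have hmem : ∀ t ∈ Set.uIcc (0 : ℝ) 1, (t : ℂ) * z ∈ unitDisk := by
    intro t ht
    rw [Set.uIcc_of_le zero_le_one] at ht
    rw [mem_ball_zero_iff, norm_mul, Complex.norm_real, Real.norm_of_nonneg ht.1]
    exact (mul_le_of_le_one_left (norm_nonneg _) ht.2).trans_lt (mem_ball_zero_iff.1 hz)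
  have h2m : 2 * m ≠ 0 := by omega
  have hderiv : ∀ t ∈ Set.uIcc (0 : ℝ) 1,
      HasDerivAt (fun t : ℝ => liftPrimitive m ((t : ℂ) * z))
        (((t : ℂ) * z) ^ m * deriv (h (2 * m)) ((t : ℂ) * z) * z) t := by
    intro t ht
    have hline : HasDerivAt (fun t : ℝ => (t : ℂ) * z) z t := by
      simpa using (Complex.ofRealCLM.hasDerivAt (x := t)).mul_const z
    rw [(hasDerivAt_h h2m (hmem t ht)).deriv]
    exact (hasDerivAt_liftPrimitive hm (hmem t ht)).comp t hline
  rw [intervalIntegral.integral_eq_sub_of_hasDerivAt hderiv]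
  · simp [liftPrimitive_zero hm]
  · apply ContinuousOn.intervalIntegrable
    have hcont : ContinuousOn (deriv (h (2 * m))) unitDisk :=
      (DifferentiableOn.deriv (fun w hw =>
        (hasDerivAt_h h2m hw).differentiableAt.differentiableWithinAt)
        Metric.isOpen_ball).continuousOn
    have hline : ContinuousOn (fun t : ℝ => (t : ℂ) * z) (Set.uIcc 0 1) := by fun_prop
    exact ((hline.pow m).mul (hcont.comp hline hmem)).mul continuousOn_const

/-! ### Univalent maps with convex image -/

/-- The filter equality encodes both continuity and openness at each point. This form applies alike
to the conformal map `F` and to its harmonic shear. -/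
theorem exists_openPartialHomeomorph {X Y : Type*} [TopologicalSpace X] [TopologicalSpace Y]
    [Nonempty X] {f : X → Y} {U : Set X} (hU : IsOpen U) (hinj : Set.InjOn f U)
    (hmap : ∀ z ∈ U, Filter.map f (nhds z) = nhds (f z)) :
    ∃ e : OpenPartialHomeomorph X Y, e.source = U ∧ e.target = f '' U ∧ (e : X → Y) = f := by
  have hopen : IsOpenMap (U.domRestrict f) := by
    rw [isOpenMap_iff_nhds_le]
    intro x
    have : Filter.map (U.domRestrict f) (nhds x) = Filter.map f (Filter.map (↑) (nhds x)) := by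
      rw [Filter.map_map]; rfl
    rw [this, hU.isOpenEmbedding_subtypeVal.map_nhds_eq, hmap x x.2]
    exact le_rfl
  have hcont : ContinuousOn f U := fun z hz =>
    ContinuousAt.continuousWithinAt (hmap z hz).le
  exact ⟨OpenPartialHomeomorph.ofContinuousOpenRestrict (hinj.toPartialEquiv f U) hcont hopen hU,
    rfl, rfl, rfl⟩

theorem map_nhds_eq_of_deriv_ne_zero {F : ℂ → ℂ} {U : Set ℂ} (hU : IsOpen U)
    (hF : DifferentiableOn ℂ F U) {z : ℂ} (hz : z ∈ U) (hne : deriv F z ≠ 0) :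
    Filter.map F (nhds z) = nhds (F z) :=
  (hF.analyticAt (hU.mem_nhds hz)).hasStrictDerivAt.map_nhds_eq hne

/-- The preimage of a straight line under a conformal map `e`. -/
theorem hasDerivAt_symm_line {e : OpenPartialHomeomorph ℂ ℂ}
    (he : DifferentiableOn ℂ e e.source) (he' : ∀ z ∈ e.source, deriv e z ≠ 0) {w d : ℂ} {t : ℝ}
    (ht : w + t * d ∈ e.target) :
    HasDerivAt (fun t : ℝ => e.symm (w + t * d)) (d / deriv e (e.symm (w + t * d))) t := by
  have hmem := e.map_target ht
  have hinv := e.hasDerivAt_symm ht (he' _ hmem)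
    (he.differentiableAt (e.open_source.mem_nhds hmem)).hasDerivAt
  have hline : HasDerivAt (fun t : ℝ => w + (t : ℂ) * d) d t := by
    simpa using ((Complex.ofRealCLM.hasDerivAt (x := t)).mul_const d).const_add w
  exact (hinv.comp t hline).congr_deriv (by rw [div_eq_inv_mul])

/-- If `|z e''| ≤ |e'|`, then `|e⁻¹|²` is convex along segments in the image of `e`. -/
theorem convexOn_norm_sq_symm_line {e : OpenPartialHomeomorph ℂ ℂ}
    (he : DifferentiableOn ℂ e e.source) (he' : ∀ z ∈ e.source, deriv e z ≠ 0)
    (he'' : ∀ z ∈ e.source, ‖z * deriv (deriv e) z‖ ≤ ‖deriv e z‖) {w d : ℂ}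
    (hseg : ∀ t ∈ Set.Icc (0 : ℝ) 1, w + t * d ∈ e.target) :
    ConvexOn ℝ (Set.Icc 0 1) fun t : ℝ => ‖e.symm (w + t * d)‖ ^ 2 := by
  set γ : ℝ → ℂ := fun t => e.symm (w + t * d) with hγ
  have hγ1 : ∀ t ∈ Set.Icc (0 : ℝ) 1, HasDerivAt γ (d / deriv e (γ t)) t := fun t ht =>
    hasDerivAt_symm_line he he' (hseg t ht)
  have hsrc : ∀ t ∈ Set.Icc (0 : ℝ) 1, γ t ∈ e.source := fun t ht => e.map_target (hseg t ht)
  -- Differentiating `γ' = d / e'(γ)` once more gives `γ'' = -(e''/e') γ'²`.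
  have hγ2 : ∀ t ∈ Set.Icc (0 : ℝ) 1, HasDerivAt (fun t => d / deriv e (γ t))
      (-(deriv (deriv e) (γ t) / deriv e (γ t)) * (d / deriv e (γ t)) ^ 2) t := by
    intro t ht
    have h2 : HasDerivAt (deriv e) (deriv (deriv e) (γ t)) (γ t) :=
      ((he.deriv e.open_source).differentiableAt
        (e.open_source.mem_nhds (hsrc t ht))).hasDerivAt
    have hne := he' _ (hsrc t ht)
    refine ((hasDerivAt_const t d).div (h2.comp t (hγ1 t ht)) hne).congr_deriv ?_
    simp only [Function.comp_apply]
    field_simp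
    ring
  refine convexOn_of_hasDerivWithinAt2_nonneg (convex_Icc 0 1)
    (f' := fun t => 2 * inner ℝ (γ t) (d / deriv e (γ t)))
    (f'' := fun t => 2 * (inner ℝ (γ t)
      (-(deriv (deriv e) (γ t) / deriv e (γ t)) * (d / deriv e (γ t)) ^ 2)
        + inner ℝ (d / deriv e (γ t)) (d / deriv e (γ t))))
    (fun t ht => (hγ1 t ht).norm_sq.continuousAt.continuousWithinAt)
    (fun t ht => (hγ1 t (interior_subset ht)).norm_sq.hasDerivWithinAt)
    (fun t ht => (((hγ1 t (interior_subset ht)).inner ℝ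
      (hγ2 t (interior_subset ht))).const_mul 2).hasDerivWithinAt) ?_
  intro t ht
  have ht' := interior_subset ht
  set v := d / deriv e (γ t)
  have hpos : 0 < ‖deriv e (γ t)‖ := norm_pos_iff.2 (he' _ (hsrc t ht'))
  -- The hypothesis gives `|γ| |γ''| ≤ |γ'|²`, so `(|γ|²)'' = 2 (⟨γ, γ''⟩ + |γ'|²) ≥ 0` by
  -- Cauchy–Schwarz.
  have hle : ‖γ t‖ * ‖-(deriv (deriv e) (γ t) / deriv e (γ t)) * v ^ 2‖ ≤ ‖v‖ ^ 2 := by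
    rw [norm_mul, norm_neg, norm_div, norm_pow, ← mul_assoc]
    refine mul_le_of_le_one_left (by positivity) ?_
    rw [← mul_div_assoc, div_le_one hpos, ← norm_mul]
    exact he'' _ (hsrc t ht')
  have hcs := (abs_le.1 (abs_real_inner_le_norm (γ t)
    (-(deriv (deriv e) (γ t) / deriv e (γ t)) * v ^ 2))).1
  rw [real_inner_self_eq_norm_sq]
  linarith

/-- A univalent function with `|z F''| ≤ |F'|` on the unit disk has convex image. -/
theorem convex_image_unitDisk {F : ℂ → ℂ} (hF : DifferentiableOn ℂ F unitDisk)
    (hinj : Set.InjOn F unitDisk) (hF' : ∀ z ∈ unitDisk, deriv F z ≠ 0)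
    (hF'' : ∀ z ∈ unitDisk, ‖z * deriv (deriv F) z‖ ≤ ‖deriv F z‖) :
    Convex ℝ (F '' unitDisk) := by
  obtain ⟨e, hsource, htarget, rfl⟩ := exists_openPartialHomeomorph Metric.isOpen_ball hinj
    fun z hz => map_nhds_eq_of_deriv_ne_zero Metric.isOpen_ball hF hz (hF' z hz)
  rw [← htarget]
  have hcont : ∀ z ∈ unitDisk, ContinuousAt e z := fun z hz =>
    (hF.differentiableAt (Metric.isOpen_ball.mem_nhds hz)).continuousAt
  let Ψ : ℂ × ℂ → ℝ → ℂ := fun p t => e p.1 + t * (e p.2 - e p.1)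
  have hΨ : ∀ p ∈ unitDisk ×ˢ unitDisk, ∀ t : ℝ,
      ContinuousAt (fun q : (ℂ × ℂ) × ℝ => Ψ q.1 q.2) (p, t) := by
    intro p hp t
    have h1 : ContinuousAt (fun q : (ℂ × ℂ) × ℝ => e q.1.1) (p, t) :=
      ContinuousAt.comp (f := fun q : (ℂ × ℂ) × ℝ => q.1.1) (hcont p.1 hp.1) (by fun_prop)
    have h2 : ContinuousAt (fun q : (ℂ × ℂ) × ℝ => e q.1.2) (p, t) :=
      ContinuousAt.comp (f := fun q : (ℂ × ℂ) × ℝ => q.1.2) (hcont p.2 hp.2) (by fun_prop)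
    exact h1.add ((by fun_prop : ContinuousAt (fun q : (ℂ × ℂ) × ℝ => (q.2 : ℂ)) (p, t)).mul
      (h2.sub h1))
  -- Continuity method: the pairs whose image segment stays in the image form an open and relatively
  -- closed subset of the connected bidisk, containing `(0, 0)`.
  let u : Set (ℂ × ℂ) := {p | p ∈ unitDisk ×ˢ unitDisk ∧ ∀ t ∈ Set.Icc (0 : ℝ) 1, Ψ p t ∈ e.target}
  have hprod : IsOpen (unitDisk ×ˢ unitDisk) := Metric.isOpen_ball.prod Metric.isOpen_ball
  have hu : IsOpen u := by
    rw [isOpen_iff_mem_nhds]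
    rintro p ⟨hp, hpt⟩
    refine Filter.inter_mem (hprod.mem_nhds hp) ?_
    exact isCompact_Icc.eventually_forall_of_forall_eventually fun t ht =>
      (hΨ p hp t).eventually (e.open_target.mem_nhds (hpt t ht))
  have hclosed : closure u ∩ unitDisk ×ˢ unitDisk ⊆ u := by
    rintro p ⟨hpu, hp⟩
    refine ⟨hp, fun t ht => ?_⟩
    have hmax : max ‖p.1‖ ‖p.2‖ < 1 :=
      max_lt (mem_ball_zero_iff.1 hp.1) (mem_ball_zero_iff.1 hp.2)
    obtain ⟨r, hpr, hr⟩ := exists_between hmax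
    have hr0 : 0 ≤ r := (norm_nonneg _).trans ((le_max_left _ _).trans hpr.le)
    have hsub : Metric.closedBall (0 : ℂ) r ⊆ unitDisk := Metric.closedBall_subset_ball hr
    have hK : IsClosed (e '' Metric.closedBall 0 r) :=
      ((isCompact_closedBall 0 r).image_of_continuousOn (hF.continuousOn.mono hsub)).isClosed
    have hN : ∀ᶠ q : ℂ × ℂ in nhds p, ‖q.1‖ < r ∧ ‖q.2‖ < r :=
      (continuous_fst.norm.continuousAt.eventually_lt_const
        ((le_max_left _ _).trans_lt hpr)).and
        (continuous_snd.norm.continuousAt.eventually_lt_const ((le_max_right _ _).trans_lt hpr))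
    -- For nearby pairs in `u`, convexity bounds `|e⁻¹|` on the segment by its endpoint values, both
    -- below `r`. Thus the segment lies in a fixed compact subset of the image, and the limit cannot
    -- escape.
    have hfreq : ∃ᶠ q in nhds p, Ψ q t ∈ e '' Metric.closedBall 0 r := by
      refine ((mem_closure_iff_frequently.1 hpu).and_eventually hN).mono ?_
      rintro q ⟨⟨hq, hqt⟩, hq1, hq2⟩
      have hconv := convexOn_norm_sq_symm_line (w := e q.1) (d := e q.2 - e q.1)
        (hsource ▸ hF) (hsource ▸ hF') (hsource ▸ hF'') hqt
      have hle := hconv.le_max_of_mem_Icc (Set.left_mem_Icc.2 zero_le_one)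
        (Set.right_mem_Icc.2 zero_le_one) ht
      have hq1' : e.symm (e q.1) = q.1 := e.left_inv (hsource ▸ hq.1)
      have hq2' : e.symm (e q.2) = q.2 := e.left_inv (hsource ▸ hq.2)
      simp only [Complex.ofReal_zero, zero_mul, add_zero, Complex.ofReal_one, one_mul,
        add_sub_cancel, hq1', hq2'] at hle
      refine ⟨e.symm (Ψ q t), ?_, e.right_inv (hqt t ht)⟩
      rw [mem_closedBall_zero_iff]
      refine le_of_sq_le_sq ?_ hr0
      exact hle.trans (max_le (by gcongr) (by gcongr))
    have htend : Filter.Tendsto (fun q => Ψ q t) (nhds p) (nhds (Ψ p t)) :=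
      ContinuousAt.comp (f := fun q : ℂ × ℂ => (q, t)) (hΨ p hp t) (by fun_prop)
    rw [htarget]
    exact Set.image_mono hsub (hK.mem_of_frequently_of_tendsto hfreq htend)
  have h0 : (0 : ℂ) ∈ unitDisk := Metric.mem_ball_self one_pos
  have hall : unitDisk ×ˢ unitDisk ⊆ u := by
    refine ((convex_ball (0 : ℂ) 1).prod (convex_ball (0 : ℂ) 1)).isPreconnected
      |>.subset_of_closure_inter_subset hu ⟨(0, 0), ⟨h0, h0⟩, ⟨h0, h0⟩, fun t _ => ?_⟩ hclosed
    simp only [Ψ, sub_self, mul_zero, add_zero, htarget]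
    exact Set.mem_image_of_mem _ h0
  rw [htarget, convex_iff_segment_subset]
  rintro _ ⟨z₁, hz₁, rfl⟩ _ ⟨z₂, hz₂, rfl⟩
  rw [segment_eq_image']
  rintro _ ⟨t, ht, rfl⟩
  have := (hall (Set.mk_mem_prod hz₁ hz₂)).2 t ht
  rw [htarget] at this
  simpa [Ψ] using this

theorem isCHDDomain_of_convex {Ω : Set ℂ} (ho : IsOpen Ω) (hc : Convex ℝ Ω) (hne : Ω.Nonempty) :
    IsCHDDomain Ω := by
  refine ⟨ho, ⟨hne, hc.isPreconnected⟩, fun c => (hc.inter ?_).isPreconnected⟩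
  exact convex_hyperplane Complex.imLm.isLinear c

/-! ### The epicycloidal map -/

theorem deriv_F (n : ℕ) : deriv (F n) = fun z : ℂ => 1 - z ^ (n - 1) / n :=
  funext fun z => (hasDerivAt_F n z).deriv

theorem differentiable_F (n : ℕ) : Differentiable ℂ (F n) := fun z =>
  (hasDerivAt_F n z).differentiableAt

/-- Factor out `z - w`; the cofactor is a sum of `n` terms of norm at most `1`. -/
theorem norm_pow_sub_pow_le {n : ℕ} {z w : ℂ} (hz : ‖z‖ ≤ 1) (hw : ‖w‖ ≤ 1) :
    ‖z ^ n - w ^ n‖ ≤ n * ‖z - w‖ := by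
  rw [← (Commute.all z w).mul_geom_sum₂, norm_mul, mul_comm]
  gcongr
  refine (norm_sum_le_of_le (n := fun _ => (1 : ℝ)) _ fun i _ => ?_).trans_eq (by simp)
  rw [norm_mul, norm_pow, norm_pow]
  exact mul_le_one₀ (pow_le_one₀ (norm_nonneg _) hz) (by positivity)
    (pow_le_one₀ (norm_nonneg _) hw)

theorem injOn_F {n : ℕ} (hn : 2 ≤ n) : Set.InjOn (F n) unitDisk := by
  intro z hz w hw hzw
  have hn' : (2 : ℝ) ≤ n := by exact_mod_cast hn
  have hn0 : (n : ℂ) ≠ 0 := by exact_mod_cast (by omega : n ≠ 0)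
  have heq : z ^ n - w ^ n = (n : ℂ) ^ 2 * (z - w) := by
    simp only [F] at hzw
    field_simp at hzw
    linear_combination -hzw
  have hle := norm_pow_sub_pow_le (n := n) (mem_ball_zero_iff.1 hz).le (mem_ball_zero_iff.1 hw).le
  rw [heq, norm_mul, norm_pow, Complex.norm_natCast] at hle
  have : ‖z - w‖ ≤ 0 := by
    by_contra! hpos
    nlinarith [mul_pos (mul_pos (by linarith : (0 : ℝ) < n) (by linarith : (0 : ℝ) < n - 1)) hpos]
  exact sub_eq_zero.1 (norm_le_zero_iff.1 this)

/-- With `ζ = z ^ (n-1)`, the left side is `(n-1)|ζ|/n`, and the right side is at least `1 - |ζ|/n`;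
the difference of these bounds is `1 - |ζ| ≥ 0`. -/
theorem norm_mul_deriv_deriv_F_le {n : ℕ} (hn : 2 ≤ n) {z : ℂ} (hz : z ∈ unitDisk) :
    ‖z * deriv (deriv (F n)) z‖ ≤ ‖deriv (F n) z‖ := by
  have hn' : (2 : ℝ) ≤ n := by exact_mod_cast hn
  have hd : deriv (deriv (F n)) z = -(((n - 1 : ℕ) : ℂ) * z ^ (n - 1 - 1) / n) := by
    rw [deriv_F]
    exact (((hasDerivAt_pow (n - 1) z).div_const (n : ℂ)).const_sub 1).deriv
  have hz1 : z * z ^ (n - 1 - 1) = z ^ (n - 1) := by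
    rw [← pow_succ']; congr 1; omega
  rw [hd, deriv_F, show z * -(((n - 1 : ℕ) : ℂ) * z ^ (n - 1 - 1) / n) =
    -(((n - 1 : ℕ) : ℂ) * z ^ (n - 1) / n) by rw [← hz1]; ring]
  have hlt := norm_pow_lt_one (n := n - 1) (by omega) hz
  beta_reduce
  generalize z ^ (n - 1) = ζ at *
  have htri : 1 - ‖ζ‖ / n ≤ ‖1 - ζ / n‖ := by
    have := norm_sub_norm_le (1 : ℂ) (ζ / n)
    rwa [norm_one, norm_div, Complex.norm_natCast] at this
  refine le_trans ?_ htri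
  rw [norm_neg, norm_div, norm_mul, Complex.norm_natCast, Complex.norm_natCast,
    Nat.cast_sub (by omega), Nat.cast_one, div_le_iff₀ (by linarith), sub_mul 1,
    div_mul_cancel₀ _ (by linarith)]
  nlinarith [norm_nonneg ζ]

theorem deriv_F_ne_zero {n : ℕ} (hn : 2 ≤ n) {z : ℂ} (hz : z ∈ unitDisk) : deriv (F n) z ≠ 0 := by
  rw [deriv_F]
  exact one_sub_pow_div_ne_zero hn hz

theorem convex_image_F {n : ℕ} (hn : 2 ≤ n) : Convex ℝ (F n '' unitDisk) :=
  convex_image_unitDisk (differentiable_F n).differentiableOn (injOn_F hn)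
    (fun _ => deriv_F_ne_zero hn) fun _ => norm_mul_deriv_deriv_F_le hn

theorem isOpen_image_of_map_nhds_eq {X Y : Type*} [TopologicalSpace X] [TopologicalSpace Y]
    {f : X → Y} {U : Set X} (hU : IsOpen U)
    (hmap : ∀ z ∈ U, Filter.map f (nhds z) = nhds (f z)) : IsOpen (f '' U) := by
  rw [isOpen_iff_mem_nhds]
  rintro _ ⟨z, hz, rfl⟩
  rw [← hmap z hz]
  exact Filter.image_mem_map (hU.mem_nhds hz)

theorem isCHDDomain_image_F {n : ℕ} (hn : 2 ≤ n) : IsCHDDomain (F n '' unitDisk) :=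
  isCHDDomain_of_convex (isOpen_image_of_map_nhds_eq Metric.isOpen_ball fun _ hz =>
      map_nhds_eq_of_deriv_ne_zero Metric.isOpen_ball (differentiable_F n).differentiableOn hz
        (deriv_F_ne_zero hn hz))
    (convex_image_F hn) (Set.Nonempty.image _ ⟨0, Metric.mem_ball_self one_pos⟩)

/-! ### Harmonic maps as real maps -/

theorem re_one_add_div_one_sub_pos {w : ℂ} (hw : ‖w‖ < 1) : 0 < ((1 + w) / (1 - w)).re := by
  have hpos : 0 < Complex.normSq (1 - w) :=
    Complex.normSq_pos.2 (one_sub_ne_zero_of_norm_lt_one hw)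
  have hsq : Complex.normSq w < 1 := by
    rw [Complex.normSq_eq_norm_sq]
    exact pow_lt_one₀ (norm_nonneg _) hw two_ne_zero
  rw [Complex.normSq_apply] at hsq
  rw [Complex.div_re, ← add_div]
  refine div_pos ?_ hpos
  simp only [Complex.add_re, Complex.one_re, Complex.sub_re, Complex.add_im, Complex.one_im,
    Complex.sub_im]
  nlinarith

/-- A kernel vector would satisfy `|a v| = |b v|`, hence vanish; finite dimension then gives
invertibility. This is the differential of a sense-preserving harmonic map. -/
theorem exists_equiv_mul_add_conj_mul {a b : ℂ} (hab : ‖b‖ < ‖a‖) :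
    ∃ L : ℂ ≃L[ℝ] ℂ, ∀ v, L v = a * v + conj (b * v) := by
  let T : ℂ →ₗ[ℝ] ℂ :=
    LinearMap.mulLeft ℝ a + Complex.conjLIE.toLinearEquiv.toLinearMap ∘ₗ LinearMap.mulLeft ℝ b
  have hT : ∀ v, T v = a * v + conj (b * v) := fun v => rfl
  have hinj : Function.Injective T := by
    rw [injective_iff_map_eq_zero]
    intro v hv
    rw [hT, add_eq_zero_iff_eq_neg] at hv
    have hnorm := congrArg norm hv
    rw [norm_neg, RCLike.norm_conj, norm_mul, norm_mul] at hnorm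
    by_contra hv0
    have := norm_pos_iff.2 hv0
    exact hab.ne' (mul_right_cancel₀ this.ne' hnorm)
  exact ⟨(LinearEquiv.ofInjectiveEndo T hinj).toContinuousLinearEquiv, hT⟩

theorem contDiffAt_harmonicMap {h g : ℂ → ℂ} {z : ℂ} (hh : AnalyticAt ℂ h z)
    (hg : AnalyticAt ℂ g z) {n : WithTop ℕ∞} : ContDiffAt ℝ n (harmonicMap h g) z :=
  (hh.contDiffAt.restrict_scalars ℝ).add
    (Complex.conjCLE.contDiff.contDiffAt.comp z (hg.contDiffAt.restrict_scalars ℝ))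

theorem hasFDerivAt_harmonicMap {h g : ℂ → ℂ} {a b z : ℂ} (hh : HasDerivAt h a z)
    (hg : HasDerivAt g b z) {L : ℂ →L[ℝ] ℂ} (hL : ∀ v, L v = a * v + conj (b * v)) :
    HasFDerivAt (harmonicMap h g) L z := by
  have h1 := hh.hasFDerivAt.restrictScalars ℝ
  have h2 := Complex.conjCLE.hasFDerivAt.comp z (hg.hasFDerivAt.restrictScalars ℝ)
  refine (h1.add h2).congr_fderiv ?_
  ext1 v
  rw [hL]
  simp [mul_comm]

theorem harmonicOnNhd_harmonicMap {h g : ℂ → ℂ} (hh : DifferentiableOn ℂ h unitDisk)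
    (hg : DifferentiableOn ℂ g unitDisk) :
    InnerProductSpace.HarmonicOnNhd (harmonicMap h g) unitDisk := fun _ hz =>
  have hz' := Metric.isOpen_ball.mem_nhds hz
  (hh.analyticAt hz').harmonicAt.add (hg.analyticAt hz').harmonicAt_conj

/-! ### The shear construction -/

namespace IsHorizontalShear

variable {F dil h g : ℂ → ℂ}

theorem analyticAt_h (H : IsHorizontalShear F dil h g) {z : ℂ} (hz : z ∈ unitDisk) :
    AnalyticAt ℂ h z :=
  H.differentiableOn_h.analyticAt (Metric.isOpen_ball.mem_nhds hz)

theorem analyticAt_g (H : IsHorizontalShear F dil h g) {z : ℂ} (hz : z ∈ unitDisk) :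
    AnalyticAt ℂ g z :=
  H.differentiableOn_g.analyticAt (Metric.isOpen_ball.mem_nhds hz)

theorem differentiableOn (H : IsHorizontalShear F dil h g) : DifferentiableOn ℂ F unitDisk :=
  (H.differentiableOn_h.sub H.differentiableOn_g).congr fun z hz => (H.sub_eq z hz).symm

theorem deriv_g_eq (H : IsHorizontalShear F dil h g) {z : ℂ} (hz : z ∈ unitDisk) :
    deriv g z = dil z * deriv h z :=
  (div_eq_iff (H.deriv_ne_zero z hz)).1 (H.dilatation_eq z hz)

theorem deriv_F_ne_zero (H : IsHorizontalShear F dil h g) (hdil : ∀ z ∈ unitDisk, ‖dil z‖ < 1)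
    {z : ℂ} (hz : z ∈ unitDisk) : deriv F z ≠ 0 := by
  rw [← H.deriv_mul_one_sub hz]
  exact mul_ne_zero (H.deriv_ne_zero z hz) (one_sub_ne_zero_of_norm_lt_one (hdil z hz))

theorem harmonicMap_im (H : IsHorizontalShear F dil h g) {z : ℂ} (hz : z ∈ unitDisk) :
    (harmonicMap h g z).im = (F z).im := by
  rw [← H.sub_eq z hz]
  simp [harmonicMap, sub_eq_add_neg]

theorem exists_hasFDerivAt_equiv (H : IsHorizontalShear F dil h g)
    (hdil : ∀ z ∈ unitDisk, ‖dil z‖ < 1) {z : ℂ} (hz : z ∈ unitDisk) :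
    ∃ L : ℂ ≃L[ℝ] ℂ, HasFDerivAt (harmonicMap h g) (L : ℂ →L[ℝ] ℂ) z := by
  have hlt : ‖deriv g z‖ < ‖deriv h z‖ := by
    rw [H.deriv_g_eq hz, norm_mul]
    exact mul_lt_of_lt_one_left (norm_pos_iff.2 (H.deriv_ne_zero z hz)) (hdil z hz)
  obtain ⟨L, hL⟩ := exists_equiv_mul_add_conj_mul hlt
  exact ⟨L, hasFDerivAt_harmonicMap (H.analyticAt_h hz).differentiableAt.hasDerivAt
    (H.analyticAt_g hz).differentiableAt.hasDerivAt hL⟩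

theorem map_nhds_harmonicMap (H : IsHorizontalShear F dil h g)
    (hdil : ∀ z ∈ unitDisk, ‖dil z‖ < 1) {z : ℂ} (hz : z ∈ unitDisk) :
    Filter.map (harmonicMap h g) (nhds z) = nhds (harmonicMap h g z) := by
  obtain ⟨L, hL⟩ := H.exists_hasFDerivAt_equiv hdil hz
  exact ((contDiffAt_harmonicMap (n := 1) (H.analyticAt_h hz)
    (H.analyticAt_g hz)).hasStrictFDerivAt' hL one_ne_zero).map_nhds_eq_of_equiv

end IsHorizontalShear

/-- The real parts of a connected horizontal slice form an interval. -/
theorem IsCHDDomain.add_mul_mem {Ω : Set ℂ} (hΩ : IsCHDDomain Ω) {w₁ w₂ : ℂ} (hw₁ : w₁ ∈ Ω)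
    (hw₂ : w₂ ∈ Ω) (him : w₁.im = w₂.im) {t : ℝ} (ht : t ∈ Set.Icc (0 : ℝ) 1) :
    w₁ + t * (w₂ - w₁) ∈ Ω := by
  have hpre := (hΩ.2.2 w₁.im).image Complex.re Complex.continuous_re.continuousOn
  have hseg := (convex_iff_segment_subset.1 (hpre.ordConnected.convex (𝕜 := ℝ)))
    (Set.mem_image_of_mem Complex.re ⟨hw₁, rfl⟩)
    (Set.mem_image_of_mem Complex.re (⟨hw₂, him.symm⟩ : w₂ ∈ Ω ∩ {w : ℂ | w.im = w₁.im}))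
  rw [segment_eq_image'] at hseg
  obtain ⟨w, ⟨hw, hwim⟩, hre⟩ := hseg (Set.mem_image_of_mem _ ht)
  convert hw using 1
  apply Complex.ext
  · simpa using hre.symm
  · have : w.im = w₁.im := hwim
    simp [this, him]

namespace IsHorizontalShear

variable {F dil h g : ℂ → ℂ}

/-- The shear of a univalent map onto a domain convex in the horizontal direction is univalent. -/
theorem injOn_harmonicMap (H : IsHorizontalShear F dil h g)
    (hdil : ∀ z ∈ unitDisk, ‖dil z‖ < 1) (hinj : Set.InjOn F unitDisk)
    (hΩ : IsCHDDomain (F '' unitDisk)) : Set.InjOn (harmonicMap h g) unitDisk := by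
  intro z₁ hz₁ z₂ hz₂ heq
  by_contra hne
  obtain ⟨e, hsource, htarget, he⟩ :=
    exists_openPartialHomeomorph (U := unitDisk) Metric.isOpen_ball hinj
      fun z hz => map_nhds_eq_of_deriv_ne_zero Metric.isOpen_ball H.differentiableOn hz
        (H.deriv_F_ne_zero hdil hz)
  have him : (F z₁).im = (F z₂).im := by
    rw [← H.harmonicMap_im hz₁, ← H.harmonicMap_im hz₂, heq]
  set d := (F z₂).re - (F z₁).re with hd_def
  have hd : (d : ℂ) = F z₂ - F z₁ := by apply Complex.ext <;> simp [hd_def, him]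
  have hd0 : d ≠ 0 := by
    intro h0
    rw [h0, Complex.ofReal_zero, eq_comm, sub_eq_zero] at hd
    exact hne (hinj hz₁ hz₂ hd.symm)
  have hmem : ∀ t ∈ Set.Icc (0 : ℝ) 1, F z₁ + t * (d : ℂ) ∈ e.target := by
    intro t ht
    rw [hd, htarget]
    exact hΩ.add_mul_mem (Set.mem_image_of_mem _ hz₁) (Set.mem_image_of_mem _ hz₂) him ht
  set γ : ℝ → ℂ := fun t => e.symm (F z₁ + t * (d : ℂ)) with hγ
  have hγmem : ∀ t ∈ Set.Icc (0 : ℝ) 1, γ t ∈ unitDisk := fun t ht =>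
    hsource.le (e.map_target (hmem t ht))
  -- Here `γ' = d / F'(γ)` with `F' = h' (1 - ω)`, so `(h' + g') γ' = d (1 + ω) / (1 - ω)`.
  have hderiv : ∀ t ∈ Set.Icc (0 : ℝ) 1, HasDerivAt (fun t => (harmonicMap h g (γ t)).re)
      (d * ((1 + dil (γ t)) / (1 - dil (γ t))).re) t := by
    intro t ht
    have hz := hγmem t ht
    have hγ' : HasDerivAt γ (d / deriv F (γ t)) t := by
      have := hasDerivAt_symm_line (e := e) (by rw [he, hsource]; exact H.differentiableOn)
        (by rw [he, hsource]; exact fun z hz => H.deriv_F_ne_zero hdil hz) (hmem t ht)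
      rwa [he] at this
    have hh := (H.analyticAt_h hz).differentiableAt.hasDerivAt.comp t hγ'
    have hg := (H.analyticAt_g hz).differentiableAt.hasDerivAt.comp t hγ'
    have hre := (Complex.reCLM.hasFDerivAt.comp_hasDerivAt t (hh.add hg))
    have hfun : (fun t => (harmonicMap h g (γ t)).re) =
        (Complex.reCLM ∘ (h ∘ γ + g ∘ γ)) := by
      funext t
      simp [harmonicMap]
    rw [hfun]
    refine hre.congr_deriv ?_
    have h1 := H.deriv_ne_zero _ hz
    have h2 := one_sub_ne_zero_of_norm_lt_one (hdil _ hz)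
    rw [H.deriv_g_eq hz, ← H.deriv_mul_one_sub hz]
    have hval : deriv h (γ t) * (d / (deriv h (γ t) * (1 - dil (γ t)))) +
        dil (γ t) * deriv h (γ t) * (d / (deriv h (γ t) * (1 - dil (γ t)))) =
        (d : ℂ) * ((1 + dil (γ t)) / (1 - dil (γ t))) := by
      field_simp
    rw [hval, Complex.reCLM_apply, Complex.re_ofReal_mul]
  have hγ0 : γ 0 = z₁ := by
    have := e.left_inv (x := z₁) (hsource ▸ hz₁)
    rw [he] at this
    simp [hγ, this]
  have hγ1 : γ 1 = z₂ := by
    have := e.left_inv (x := z₂) (hsource ▸ hz₂)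
    rw [he] at this
    simp [hγ, this, hd]
  -- Rolle: `f z₁ = f z₂` gives equal real parts at the ends, but the derivative never vanishes.
  obtain ⟨t, ht, ht0⟩ := exists_hasDerivAt_eq_zero zero_lt_one
    (fun t ht => (hderiv t ht).continuousAt.continuousWithinAt) (by simp only [hγ0, hγ1, heq])
    (fun t ht => hderiv t (Set.Ioo_subset_Icc_self ht))
  exact mul_ne_zero hd0
    (re_one_add_div_one_sub_pos (hdil _ (hγmem t (Set.Ioo_subset_Icc_self ht)))).ne' ht0

theorem continuousOn_harmonicMap (H : IsHorizontalShear F dil h g) :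
    ContinuousOn (harmonicMap h g) unitDisk :=
  H.differentiableOn_h.continuousOn.add
    (Complex.continuous_conj.comp_continuousOn H.differentiableOn_g.continuousOn)

/-- The shear of a univalent map onto a domain convex in the horizontal direction has image
convex in the horizontal direction. -/
theorem isCHDDomain_image_harmonicMap (H : IsHorizontalShear F dil h g)
    (hdil : ∀ z ∈ unitDisk, ‖dil z‖ < 1) (hinj : Set.InjOn F unitDisk)
    (hΩ : IsCHDDomain (F '' unitDisk)) : IsCHDDomain (harmonicMap h g '' unitDisk) := by
  refine ⟨isOpen_image_of_map_nhds_eq Metric.isOpen_ball fun _ => H.map_nhds_harmonicMap hdil,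
    (Metric.isConnected_ball one_pos).image _ H.continuousOn_harmonicMap, fun c => ?_⟩
  obtain ⟨e, hsource, htarget, he⟩ :=
    exists_openPartialHomeomorph (U := unitDisk) Metric.isOpen_ball hinj
      fun z hz => map_nhds_eq_of_deriv_ne_zero Metric.isOpen_ball H.differentiableOn hz
        (H.deriv_F_ne_zero hdil hz)
  have hmaps : Set.MapsTo e.symm (F '' unitDisk) unitDisk := by
    rw [← htarget, ← hsource]
    exact e.mapsTo_symm
  have hcont : ContinuousOn (harmonicMap h g ∘ e.symm) (F '' unitDisk) :=
    H.continuousOn_harmonicMap.comp (htarget ▸ e.continuousOn_symm) hmaps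
  -- As `Im f = Im F`, the map `f ∘ F⁻¹` preserves heights, so each slice is a continuous image of a
  -- connected slice.
  have hset : harmonicMap h g '' unitDisk ∩ {w : ℂ | w.im = c} =
      (harmonicMap h g ∘ e.symm) '' (F '' unitDisk ∩ {w : ℂ | w.im = c}) := by
    have hleft : ∀ z ∈ unitDisk, e.symm (F z) = z := fun z hz => by
      have := e.left_inv (x := z) (hsource ▸ hz)
      rwa [he] at this
    ext w
    constructor
    · rintro ⟨⟨z, hz, rfl⟩, hw⟩
      refine ⟨F z, ⟨Set.mem_image_of_mem _ hz, ?_⟩, by rw [Function.comp_apply, hleft z hz]⟩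
      rwa [Set.mem_ofPred_eq, ← H.harmonicMap_im hz]
    · rintro ⟨_, ⟨⟨z, hz, rfl⟩, hw⟩, rfl⟩
      rw [Function.comp_apply, hleft z hz]
      refine ⟨Set.mem_image_of_mem _ hz, ?_⟩
      rwa [Set.mem_ofPred_eq, H.harmonicMap_im hz]
  rw [hset]
  exact (hΩ.2.2 c).image _ (hcont.mono Set.inter_subset_left)

end IsHorizontalShear

theorem f_mem_SH0 {n : ℕ} (hn : 2 ≤ n) : f n ∈ SH0 := by
  have hn0 : n ≠ 0 := by omega
  have H := isHorizontalShear hn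
  have h0 : (0 : ℂ) ∈ unitDisk := Metric.mem_ball_self one_pos
  refine ⟨harmonicOnNhd_harmonicMap H.differentiableOn_h H.differentiableOn_g,
    H.injOn_harmonicMap (fun _ => norm_pow_lt_one hn0) (injOn_F hn) (isCHDDomain_image_F hn),
    h n, g n, H.differentiableOn_h, H.differentiableOn_g, fun _ _ => rfl, H.map_zero_h,
    H.map_zero_g, ?_, ?_⟩
  · rw [(hasDerivAt_h hn0 h0).deriv]
    simp [hn0, show n - 1 ≠ 0 by omega]
  · rw [(hasDerivAt_g hn0 h0).deriv]
    simp [hn0]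

/-! ### Mean curvature of graphs -/

theorem hasFDerivAt_vec3 {E : Type*} [NormedAddCommGroup E] [NormedSpace ℝ E] {a b c : E → ℝ}
    {a' b' c' : E →L[ℝ] ℝ} {p : E} (ha : HasFDerivAt a a' p) (hb : HasFDerivAt b b' p)
    (hc : HasFDerivAt c c' p) :
    HasFDerivAt (fun w => ![a w, b w, c w]) (ContinuousLinearMap.pi ![a', b', c']) p := by
  rw [hasFDerivAt_pi']
  intro i
  fin_cases i
  exacts [ha, hb, hc]

theorem fderiv_vec3_apply {E : Type*} [NormedAddCommGroup E] [NormedSpace ℝ E] {a b c : E → ℝ}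
    {a' b' c' : E →L[ℝ] ℝ} {p : E} (ha : HasFDerivAt a a' p) (hb : HasFDerivAt b b' p)
    (hc : HasFDerivAt c c' p) (v : E) :
    fderiv ℝ (fun w => ![a w, b w, c w]) p v = ![a' v, b' v, c' v] := by
  rw [(hasFDerivAt_vec3 ha hb hc).fderiv]
  ext i
  fin_cases i <;> rfl

theorem fderiv_graphMap_apply {φ : ℂ → ℝ} {w : ℂ} (hφ : DifferentiableAt ℝ φ w) (v : ℂ) :
    fderiv ℝ (graphMap φ) w v = ![v.re, v.im, fderiv ℝ φ w v] :=
  fderiv_vec3_apply Complex.reCLM.hasFDerivAt Complex.imCLM.hasFDerivAt hφ.hasFDerivAt v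

theorem differentiableAt_fderiv_apply {φ : ℂ → ℝ} {w : ℂ} (hφ : ContDiffAt ℝ 2 φ w) (v : ℂ) :
    DifferentiableAt ℝ (fun w => fderiv ℝ φ w v) w :=
  ((hφ.fderiv_right (m := 1) (by norm_num)).differentiableAt one_ne_zero).clm_apply
    (differentiableAt_const v)

theorem fderiv_fderiv_graphMap_apply {φ : ℂ → ℝ} {w : ℂ} (hφ : ContDiffAt ℝ 2 φ w) (u v : ℂ) :
    fderiv ℝ (fun w => fderiv ℝ (graphMap φ) w u) w v =
      ![0, 0, fderiv ℝ (fun w => fderiv ℝ φ w u) w v] := by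
  have hev : (fun w => fderiv ℝ (graphMap φ) w u) =ᶠ[nhds w]
      fun w => ![u.re, u.im, fderiv ℝ φ w u] :=
    (hφ.eventually (by simp)).mono fun w' hw' =>
      fderiv_graphMap_apply (hw'.differentiableAt two_ne_zero) u
  rw [hev.fderiv_eq, fderiv_vec3_apply (hasFDerivAt_const _ _) (hasFDerivAt_const _ _)
    (differentiableAt_fderiv_apply hφ u).hasFDerivAt]
  simp

/-- A solution of the minimal surface equation has a graph of zero mean curvature. -/
theorem meanCurvature_graphMap_eq_zero {φ : ℂ → ℝ} {w : ℂ} (hφ : ContDiffAt ℝ 2 φ w)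
    (heq : (1 + fderiv ℝ φ w Complex.I ^ 2) * fderiv ℝ (fun w => fderiv ℝ φ w 1) w 1
      - 2 * (fderiv ℝ φ w 1 * fderiv ℝ φ w Complex.I)
        * fderiv ℝ (fun w => fderiv ℝ φ w Complex.I) w 1
      + (1 + fderiv ℝ φ w 1 ^ 2)
        * fderiv ℝ (fun w => fderiv ℝ φ w Complex.I) w Complex.I = 0) :
    meanCurvature (graphMap φ) w = 0 := by
  have hd := hφ.differentiableAt two_ne_zero
  have hX : partialX (graphMap φ) w = ![1, 0, fderiv ℝ φ w 1] := fderiv_graphMap_apply hd 1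
  have hY : partialY (graphMap φ) w = ![0, 1, fderiv ℝ φ w Complex.I] :=
    fderiv_graphMap_apply hd Complex.I
  have hXX : partialX (partialX (graphMap φ)) w = _ := fderiv_fderiv_graphMap_apply hφ 1 1
  have hXY : partialX (partialY (graphMap φ)) w = _ :=
    fderiv_fderiv_graphMap_apply hφ Complex.I 1
  have hYY : partialY (partialY (graphMap φ)) w = _ :=
    fderiv_fderiv_graphMap_apply hφ Complex.I Complex.I
  rw [meanCurvature]
  rw [hXX, hXY, hYY, hX, hY]
  -- The second derivatives of a graph are vertical, so only the third component of the normal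
  -- enters, as a common factor; its value is irrelevant.
  generalize unitNormal (graphMap φ) w = N
  simp only [dotProduct, Fin.sum_univ_three, Matrix.cons_val_zero, Matrix.cons_val_one,
    Matrix.cons_val]
  rw [div_eq_zero_iff]
  left
  linear_combination N 2 * heq

/-! ### Weierstrass–Enneper lifts -/

/-- The lift to a surface in `ℝ³` of the harmonic map `h + conj g`, with third coordinate
`2 Im K`. -/
def weierstrassLift (h g K : ℂ → ℂ) (z : ℂ) : Fin 3 → ℝ :=
  ![(h z + g z).re, (h z - g z).im, 2 * (K z).im]

theorem hasFDerivAt_re {h : ℂ → ℂ} {a z : ℂ} (hh : HasDerivAt h a z) :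
    HasFDerivAt (fun z => (h z).re)
      (Complex.reCLM ∘L (ContinuousLinearMap.mul ℝ ℂ a)) z := by
  refine (Complex.reCLM.hasFDerivAt.comp z (hh.hasFDerivAt.restrictScalars ℝ)).congr_fderiv ?_
  ext1 v
  simp [mul_comm]

theorem hasFDerivAt_im {h : ℂ → ℂ} {a z : ℂ} (hh : HasDerivAt h a z) :
    HasFDerivAt (fun z => (h z).im)
      (Complex.imCLM ∘L (ContinuousLinearMap.mul ℝ ℂ a)) z := by
  refine (Complex.imCLM.hasFDerivAt.comp z (hh.hasFDerivAt.restrictScalars ℝ)).congr_fderiv ?_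
  ext1 v
  simp [mul_comm]

theorem fderiv_weierstrassLift_apply {h g K : ℂ → ℂ} {a b k z : ℂ} (hh : HasDerivAt h a z)
    (hg : HasDerivAt g b z) (hK : HasDerivAt K k z) (v : ℂ) :
    fderiv ℝ (weierstrassLift h g K) z v =
      ![((a + b) * v).re, ((a - b) * v).im, 2 * (k * v).im] :=
  fderiv_vec3_apply (hasFDerivAt_re (hh.add hg)) (hasFDerivAt_im (hh.sub hg))
    ((hasFDerivAt_im hK).const_mul 2) v

theorem contDiffAt_weierstrassLift {h g K : ℂ → ℂ} {z : ℂ} (hh : AnalyticAt ℂ h z)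
    (hg : AnalyticAt ℂ g z) (hK : AnalyticAt ℂ K z) {n : WithTop ℕ∞} :
    ContDiffAt ℝ n (weierstrassLift h g K) z := by
  have hre : ∀ {u : ℂ → ℂ}, AnalyticAt ℂ u z → ContDiffAt ℝ n (fun z => (u z).re) z :=
    fun hu => Complex.reCLM.contDiff.contDiffAt.comp z (hu.contDiffAt.restrict_scalars ℝ)
  have him : ∀ {u : ℂ → ℂ}, AnalyticAt ℂ u z → ContDiffAt ℝ n (fun z => (u z).im) z :=
    fun hu => Complex.imCLM.contDiff.contDiffAt.comp z (hu.contDiffAt.restrict_scalars ℝ)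
  rw [contDiffAt_pi]
  intro i
  fin_cases i
  exacts [hre (hh.add hg), him (hh.sub hg), contDiffAt_const.mul (him hK)]

/-- Since `g' = ζ² h'` and `K' = ζ h'`, both diagonal metric coefficients equal `|h'|² (1 + |ζ|²)²`.
-/
theorem isIsothermal_weierstrassLift {h g K ζ : ℂ → ℂ}
    (hh : DifferentiableOn ℂ h unitDisk) (hg : DifferentiableOn ℂ g unitDisk)
    (hh' : ∀ z ∈ unitDisk, deriv h z ≠ 0)
    (hg' : ∀ z ∈ unitDisk, deriv g z = ζ z ^ 2 * deriv h z)
    (hK : ∀ z ∈ unitDisk, HasDerivAt K (ζ z * deriv h z) z) :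
    IsIsothermal (weierstrassLift h g K) := by
  have hKd : DifferentiableOn ℂ K unitDisk := fun z hz =>
    (hK z hz).differentiableAt.differentiableWithinAt
  refine ⟨fun z hz => ?_, fun z hz => ?_⟩
  · have hz' := Metric.isOpen_ball.mem_nhds hz
    exact (contDiffAt_weierstrassLift (hh.analyticAt hz') (hg.analyticAt hz')
      (hKd.analyticAt hz')).contDiffWithinAt
  · have hz' := Metric.isOpen_ball.mem_nhds hz
    have hX := fderiv_weierstrassLift_apply (hh.differentiableAt hz').hasDerivAt
      (hg.differentiableAt hz').hasDerivAt (hK z hz)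
    have hne := hh' z hz
    simp only [partialX, partialY, hX, hg' z hz]
    have hpos : 0 < Complex.normSq (deriv h z) := Complex.normSq_pos.2 hne
    generalize deriv h z = p at hpos
    generalize ζ z = w
    rw [Complex.normSq_apply] at hpos
    simp only [dotProduct, Fin.sum_univ_three, Matrix.cons_val_zero, Matrix.cons_val_one,
      Matrix.cons_val, mul_one, pow_two, Complex.add_re, Complex.add_im, Complex.sub_re,
      Complex.sub_im, Complex.mul_re, Complex.mul_im, Complex.I_re, Complex.I_im]
    refine ⟨?_, by ring, by ring⟩
    have : 0 < (p.re * p.re + p.im * p.im) * (1 + (w.re ^ 2 + w.im ^ 2)) ^ 2 := by positivity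
    refine this.trans_eq ?_
    ring

/-- The slope of the lift in terms of the square root `w` of the dilatation. -/
theorem slope_eq {U V : ℝ} {w : ℂ} (hw : ‖w‖ < 1)
    (heq : ∀ v : ℂ, U * ((1 + w ^ 2) * v).re + V * ((1 - w ^ 2) * v).im = 2 * (w * v).im) :
    U * (1 - Complex.normSq w) = 2 * w.im ∧ V * (1 - Complex.normSq w) = 2 * w.re := by
  have hsq : Complex.normSq w < 1 := by
    rw [Complex.normSq_eq_norm_sq]
    exact pow_lt_one₀ (norm_nonneg _) hw two_ne_zero
  have h1 := heq 1
  have hI := heq Complex.I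
  have hpos : 0 ≤ Complex.normSq w := Complex.normSq_nonneg w
  rw [Complex.normSq_apply] at *
  simp only [mul_one, pow_two, Complex.add_re, Complex.add_im, Complex.sub_re, Complex.one_re,
    Complex.one_im, Complex.sub_im, Complex.mul_re, Complex.mul_im, Complex.I_re,
    Complex.I_im] at h1 hI
  generalize w.re = a at *
  generalize w.im = b at *
  -- Cramer's rule for the equations at `v = 1` and `v = I`: the determinant is `1 - |w|⁴`, and the
  -- factor `1 + |w|²` cancels.
  have hne : 1 + (a * a + b * b) ≠ 0 := by linarith
  constructor
  · apply mul_left_cancel₀ hne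
    linear_combination (1 - a * a + b * b) * h1 + 2 * a * b * hI
  · apply mul_left_cancel₀ hne
    linear_combination 2 * a * b * h1 + (1 + a * a - b * b) * hI

theorem fderiv_apply_eq_re_im (L : ℂ →L[ℝ] ℝ) (v : ℂ) :
    L v = L 1 * v.re + L Complex.I * v.im := by
  conv_lhs => rw [← Complex.re_add_im v]
  have : (v.re : ℂ) + v.im * Complex.I = v.re • (1 : ℂ) + v.im • Complex.I := by simp
  rw [this, map_add, map_smul, map_smul, smul_eq_mul, smul_eq_mul]
  ring

theorem mul_add_conj_mul_re (a b v : ℂ) : (a * v + conj (b * v)).re = ((a + b) * v).re := by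
  simp [add_mul]

theorem mul_add_conj_mul_im (a b v : ℂ) : (a * v + conj (b * v)).im = ((a - b) * v).im := by
  simp [sub_mul]
  ring

/-- Differentiating `U Re (S v) + V Im (D v) = 2 Im (k v)` in the direction `v`. -/
theorem deriv_slope_relation {U V : ℂ → ℝ} {S D k : ℂ → ℂ} {S' D' k' z v : ℂ} {U' V' : ℂ →L[ℝ] ℝ}
    (hU : HasFDerivAt U U' z) (hV : HasFDerivAt V V' z) (hS : HasDerivAt S S' z)
    (hD : HasDerivAt D D' z) (hk : HasDerivAt k k' z)
    (hev : ∀ᶠ z' in nhds z, U z' * (S z' * v).re + V z' * (D z' * v).im = 2 * (k z' * v).im) :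
    U' v * (S z * v).re + U z * (S' * (v * v)).re + (V' v * (D z * v).im + V z * (D' * (v * v)).im)
      = 2 * (k' * (v * v)).im := by
  have hl := (hU.mul (hasFDerivAt_re (hS.mul_const v))).add
    (hV.mul (hasFDerivAt_im (hD.mul_const v)))
  have hr := (hasFDerivAt_im (hk.mul_const v)).const_mul 2
  have heq := hl.unique (hr.congr_of_eventuallyEq hev)
  have := congrArg (fun L : ℂ →L[ℝ] ℝ => L v) heq
  simp only [add_apply, smul_apply,
    ContinuousLinearMap.comp_apply, ContinuousLinearMap.mul_apply', Complex.reCLM_apply,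
    Complex.imCLM_apply, smul_eq_mul, mul_assoc] at this
  linear_combination this

/-- The lift of `h + conj g` with dilatation `ζ ^ 2` and third coordinate `2 Im ∫ ζ h'`
satisfies the minimal surface equation wherever it is locally a graph. -/
theorem minimal_surface_equation {h g K ζ : ℂ → ℂ} {φ : ℂ → ℝ} {z : ℂ} (hh : AnalyticAt ℂ h z)
    (hg : AnalyticAt ℂ g z) (hh' : deriv h z ≠ 0) (hζ : ‖ζ z‖ < 1)
    (hg' : deriv g z = ζ z ^ 2 * deriv h z) (hK : AnalyticAt ℂ K z)
    (hK' : deriv K z = ζ z * deriv h z) (hφ : ContDiffAt ℝ 2 φ (harmonicMap h g z))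
    (hgraph : ∀ᶠ z' in nhds z, φ (harmonicMap h g z') = 2 * (K z').im) :
    (1 + fderiv ℝ φ (harmonicMap h g z) Complex.I ^ 2)
        * fderiv ℝ (fun w => fderiv ℝ φ w 1) (harmonicMap h g z) 1
      - 2 * (fderiv ℝ φ (harmonicMap h g z) 1 * fderiv ℝ φ (harmonicMap h g z) Complex.I)
        * fderiv ℝ (fun w => fderiv ℝ φ w Complex.I) (harmonicMap h g z) 1
      + (1 + fderiv ℝ φ (harmonicMap h g z) 1 ^ 2)
        * fderiv ℝ (fun w => fderiv ℝ φ w Complex.I) (harmonicMap h g z) Complex.I = 0 := by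
  have hfd : ∀ {z'}, AnalyticAt ℂ h z' → AnalyticAt ℂ g z' →
      ∃ L : ℂ →L[ℝ] ℂ, (∀ v, L v = deriv h z' * v + conj (deriv g z' * v)) ∧
        HasFDerivAt (harmonicMap h g) L z' := by
    intro z' hh hg
    exact ⟨ContinuousLinearMap.mul ℝ ℂ (deriv h z') +
      Complex.conjCLE.toContinuousLinearMap ∘L ContinuousLinearMap.mul ℝ ℂ (deriv g z'),
      fun v => rfl, hasFDerivAt_harmonicMap hh.differentiableAt.hasDerivAt
        hg.differentiableAt.hasDerivAt fun v => rfl⟩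
  have hcont : ContinuousAt (harmonicMap h g) z :=
    (contDiffAt_harmonicMap (n := 0) hh hg).continuousAt
  -- The chain rule for `φ ∘ f = 2 Im K`, on a neighbourhood so that it can be differentiated again.
  have hfirst : ∀ᶠ z' in nhds z, ∀ v : ℂ,
      fderiv ℝ φ (harmonicMap h g z') 1 * ((deriv h z' + deriv g z') * v).re
        + fderiv ℝ φ (harmonicMap h g z') Complex.I * ((deriv h z' - deriv g z') * v).im
        = 2 * (deriv K z' * v).im := by
    filter_upwards [hgraph.eventually_nhds, hh.eventually_analyticAt, hg.eventually_analyticAt,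
      hK.eventually_analyticAt, hcont.eventually (hφ.eventually (by simp))] with z' h1 h2 h3 h4 h5 v
    obtain ⟨L, hL, hLf⟩ := hfd h2 h3
    have hcomp := (h5.differentiableAt two_ne_zero).hasFDerivAt.comp z' hLf
    have hx := (hasFDerivAt_im h4.differentiableAt.hasDerivAt).const_mul 2
    have := congrArg (fun T : ℂ →L[ℝ] ℝ => T v) (hcomp.unique (hx.congr_of_eventuallyEq h1))
    simp only [ContinuousLinearMap.comp_apply, smul_apply, hL,
      ContinuousLinearMap.mul_apply', Complex.imCLM_apply, smul_eq_mul] at this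
    rw [fderiv_apply_eq_re_im, mul_add_conj_mul_re, mul_add_conj_mul_im] at this
    exact this
  obtain ⟨L, hL, hLf⟩ := hfd hh hg
  have hφu := (differentiableAt_fderiv_apply hφ 1).hasFDerivAt
  have hφv := (differentiableAt_fderiv_apply hφ Complex.I).hasFDerivAt
  have hsymm : fderiv ℝ (fun w => fderiv ℝ φ w 1) (harmonicMap h g z) Complex.I =
      fderiv ℝ (fun w => fderiv ℝ φ w Complex.I) (harmonicMap h g z) 1 := by
    have hd := (hφ.fderiv_right (m := 1) (by norm_num)).differentiableAt one_ne_zero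
    have hs : IsSymmSndFDerivAt ℝ φ (harmonicMap h g z) := hφ.isSymmSndFDerivAt (by simp)
    rw [fderiv_clm_apply hd (differentiableAt_const _),
      fderiv_clm_apply hd (differentiableAt_const _)]
    simpa using hs.eq Complex.I 1
  have hsecond := fun v => deriv_slope_relation (v := v) (hφu.comp z hLf) (hφv.comp z hLf)
    (hh.deriv.differentiableAt.hasDerivAt.add hg.deriv.differentiableAt.hasDerivAt)
    (hh.deriv.differentiableAt.hasDerivAt.sub hg.deriv.differentiableAt.hasDerivAt)
    hK.deriv.differentiableAt.hasDerivAt (hfirst.mono fun z' hz' => hz' v)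
  simp only [ContinuousLinearMap.comp_apply, hL] at hsecond
  have h1 := hsecond 1
  have hI := hsecond Complex.I
  rw [fderiv_apply_eq_re_im (fderiv ℝ (fun w => fderiv ℝ φ w 1) _),
    fderiv_apply_eq_re_im (fderiv ℝ (fun w => fderiv ℝ φ w Complex.I) _),
    mul_add_conj_mul_re, mul_add_conj_mul_im, hsymm] at h1 hI
  have hslope := slope_eq (U := fderiv ℝ φ (harmonicMap h g z) 1)
    (V := fderiv ℝ φ (harmonicMap h g z) Complex.I) hζ (by
      intro v
      have := hfirst.self_of_nhds (v / deriv h z)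
      rw [hK', hg', show (deriv h z + ζ z ^ 2 * deriv h z) * (v / deriv h z) = (1 + ζ z ^ 2) * v
          by field_simp, show (deriv h z - ζ z ^ 2 * deriv h z) * (v / deriv h z) =
          (1 - ζ z ^ 2) * v by field_simp, show ζ z * deriv h z * (v / deriv h z) = ζ z * v
          by field_simp] at this
      exact this)
  obtain ⟨hU, hV⟩ := hslope
  -- Adding the relations for `v = 1` and `v = I` cancels every term in `h''`, `g''`, `K''`, because
  -- `v * v` is `1` and `-1`.
  have hlap : fderiv ℝ (fun w => fderiv ℝ φ w 1) (harmonicMap h g z) 1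
        * ((deriv h z + deriv g z).re ^ 2 + (deriv h z + deriv g z).im ^ 2)
      + 2 * fderiv ℝ (fun w => fderiv ℝ φ w Complex.I) (harmonicMap h g z) 1
        * ((deriv h z + deriv g z).re * (deriv h z - deriv g z).im
          - (deriv h z + deriv g z).im * (deriv h z - deriv g z).re)
      + fderiv ℝ (fun w => fderiv ℝ φ w Complex.I) (harmonicMap h g z) Complex.I
        * ((deriv h z - deriv g z).re ^ 2 + (deriv h z - deriv g z).im ^ 2) = 0 := by
    simp only [Pi.add_apply, Pi.sub_apply, mul_one, Complex.I_mul_I, mul_neg, Complex.neg_re,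
      Complex.neg_im, Complex.mul_I_re, Complex.mul_I_im] at h1 hI
    linear_combination h1 + hI
  rw [hg'] at hlap
  have hp : 0 < Complex.normSq (deriv h z) := Complex.normSq_pos.2 hh'
  have hr : 0 < 1 - Complex.normSq (ζ z) := by
    rw [Complex.normSq_eq_norm_sq, sub_pos]
    exact pow_lt_one₀ (norm_nonneg _) hζ two_ne_zero
  rw [Complex.normSq_apply] at hp hr hU hV
  clear h1 hI hsecond hsymm hφu hφv hfirst hfd
  generalize fderiv ℝ (fun w => fderiv ℝ φ w 1) (harmonicMap h g z) 1 = A at *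
  generalize fderiv ℝ (fun w => fderiv ℝ φ w Complex.I) (harmonicMap h g z) 1 = B at *
  generalize fderiv ℝ (fun w => fderiv ℝ φ w Complex.I) (harmonicMap h g z) Complex.I = C at *
  generalize fderiv ℝ φ (harmonicMap h g z) 1 = U at *
  generalize fderiv ℝ φ (harmonicMap h g z) Complex.I = V at *
  simp only [pow_two, Complex.add_re, Complex.add_im, Complex.sub_re, Complex.sub_im,
    Complex.mul_re, Complex.mul_im] at hlap
  generalize (ζ z).re = a at *
  generalize (ζ z).im = b at *
  generalize (deriv h z).re = p at *
  generalize (deriv h z).im = q at *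
  -- After scaling by `|h'|² (1 - |ζ|²)²`, the slope formulas turn `1 + V²` and `1 + U²` into `|h' +
  -- g'|²` and `|h' - g'|²`, the coefficients in `hlap`; the mixed term matches likewise.
  refine mul_left_cancel₀ (mul_pos hp (pow_pos hr 2)).ne' ?_
  linear_combination hlap
    + (p * p + q * q) * (A * (V * (1 - (a * a + b * b)) + 2 * a) - 4 * B * b) * hV
    + (p * p + q * q) * (C * (U * (1 - (a * a + b * b)) + 2 * b)
      - 2 * B * (V * (1 - (a * a + b * b)))) * hU

/-- A univalent harmonic map whose dilatation is a square lifts to a minimal graph. -/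
theorem IsHorizontalShear.liftsToMinimalGraph {F ζ h g K : ℂ → ℂ}
    (H : IsHorizontalShear F (fun z => ζ z ^ 2) h g) (hζ : ∀ z ∈ unitDisk, ‖ζ z‖ < 1)
    (hinj : Set.InjOn (harmonicMap h g) unitDisk)
    (hK : ∀ z ∈ unitDisk, HasDerivAt K (ζ z * deriv h z) z) :
    LiftsToMinimalGraph (harmonicMap h g) (weierstrassLift h g K) := by
  have hdil : ∀ z ∈ unitDisk, ‖ζ z ^ 2‖ < 1 := fun z hz => by
    rw [norm_pow]
    exact pow_lt_one₀ (norm_nonneg _) (hζ z hz) two_ne_zero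
  have hKa : ∀ z ∈ unitDisk, AnalyticAt ℂ K z := fun z hz =>
    DifferentiableOn.analyticAt (fun z hz => (hK z hz).differentiableAt.differentiableWithinAt)
      (Metric.isOpen_ball.mem_nhds hz)
  refine ⟨isIsothermal_weierstrassLift H.differentiableOn_h H.differentiableOn_g H.deriv_ne_zero
    (fun z hz => H.deriv_g_eq hz) hK, ?_⟩
  obtain ⟨e, hsource, htarget, he⟩ :=
    exists_openPartialHomeomorph (U := unitDisk) Metric.isOpen_ball hinj
      fun z hz => H.map_nhds_harmonicMap hdil hz
  have hleft : ∀ z ∈ unitDisk, e.symm (harmonicMap h g z) = z := fun z hz => by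
    have := e.left_inv (x := z) (hsource ▸ hz)
    rwa [he] at this
  have hφ : ∀ z ∈ unitDisk,
      ContDiffAt ℝ ∞ (fun w => 2 * (K (e.symm w)).im) (harmonicMap h g z) := by
    intro z hz
    obtain ⟨L, hL⟩ := H.exists_hasFDerivAt_equiv hdil hz
    -- Inverse function theorem: `|g'| < |h'|` makes the differential of `f` invertible.
    have hsymm : ContDiffAt ℝ ∞ e.symm (harmonicMap h g z) := by
      refine e.contDiffAt_symm (f₀' := L) (htarget ▸ Set.mem_image_of_mem _ hz) ?_ ?_
      · rw [hleft z hz, he]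
        exact hL
      · rw [hleft z hz, he]
        exact contDiffAt_harmonicMap (H.analyticAt_h hz) (H.analyticAt_g hz)
    have hKz : ContDiffAt ℝ ∞ K (e.symm (harmonicMap h g z)) := by
      rw [hleft z hz]
      exact (hKa z hz).contDiffAt.restrict_scalars ℝ
    exact contDiffAt_const.mul
      (Complex.imCLM.contDiff.contDiffAt.comp _ (hKz.comp _ hsymm))
  refine ⟨fun w => 2 * (K (e.symm w)).im, ⟨htarget ▸ e.open_target, ?_, ?_⟩, fun z hz => ?_⟩
  · rintro _ ⟨z, hz, rfl⟩
    exact (hφ z hz).contDiffWithinAt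
  · rintro _ ⟨z, hz, rfl⟩
    have hφ2 := contDiffAt_infty.1 (hφ z hz) 2
    refine meanCurvature_graphMap_eq_zero hφ2 ?_
    refine minimal_surface_equation (H.analyticAt_h hz) (H.analyticAt_g hz)
      (H.deriv_ne_zero z hz) (hζ z hz) (H.deriv_g_eq hz) (hKa z hz) (hK z hz).deriv hφ2 ?_
    filter_upwards [Metric.isOpen_ball.mem_nhds hz] with z' hz'
    rw [hleft z' hz']
  · rw [graphMap, hleft z hz, weierstrassLift]
    ext i
    fin_cases i <;> simp [harmonicMap, sub_eq_add_neg]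

theorem liftsToMinimalGraph_f {m : ℕ} (hm : m ≠ 0) : LiftsToMinimalGraph (f (2 * m)) (lift m) := by
  have hn : 2 ≤ 2 * m := by omega
  have H := isHorizontalShear hn
  have hinj := H.injOn_harmonicMap (fun _ => norm_pow_lt_one (by omega)) (injOn_F hn)
    (isCHDDomain_image_F hn)
  have hsq : (fun z : ℂ => z ^ (2 * m)) = fun z : ℂ => (z ^ m) ^ 2 :=
    funext fun z => pow_mul' z 2 m
  rw [hsq] at H
  refine H.liftsToMinimalGraph (K := liftPrimitive m) (fun _ => norm_pow_lt_one hm) hinj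
    fun z hz => ?_
  rw [(hasDerivAt_h (by omega) hz).deriv]
  exact hasDerivAt_liftPrimitive hm hz

end EpicycloidShear

end

theorem theorem6 (n : ℕ) (hn : 2 ≤ n) :
    -- `F_n` is a conformal univalent map onto a domain convex in the horizontal direction
    (EpicycloidShear.IsConformalUnivalent (EpicycloidShear.F n) ∧
      EpicycloidShear.IsCHDDomain (EpicycloidShear.F n '' EpicycloidShear.unitDisk)) ∧
    -- `h_n + conj g_n` is the horizontal shear of `F_n` with dilatation `z ^ n`
    (EpicycloidShear.IsHorizontalShear (EpicycloidShear.F n) (fun z => z ^ n)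
        (EpicycloidShear.h n) (EpicycloidShear.g n) ∧
      ∀ h g : ℂ → ℂ,
        EpicycloidShear.IsHorizontalShear (EpicycloidShear.F n) (fun z => z ^ n) h g →
          Set.EqOn h (EpicycloidShear.h n) EpicycloidShear.unitDisk ∧
          Set.EqOn g (EpicycloidShear.g n) EpicycloidShear.unitDisk) ∧
    -- `f_n` belongs to `S_H^0`, and its image is convex in the horizontal direction
    (EpicycloidShear.f n ∈ EpicycloidShear.SH0 ∧
      EpicycloidShear.IsCHDDomain (EpicycloidShear.f n '' EpicycloidShear.unitDisk)) ∧
    -- for even `n` the map `f_n` lifts to a minimal graph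
    (∀ m : ℕ, n = 2 * m →
      EpicycloidShear.LiftsToMinimalGraph (EpicycloidShear.f n) (EpicycloidShear.lift m) ∧
      ∀ z ∈ EpicycloidShear.unitDisk,
        EpicycloidShear.x₃ m z =
          2 * (∫ t in (0 : ℝ)..1,
            ((t : ℂ) * z) ^ m * deriv (EpicycloidShear.h n) ((t : ℂ) * z) * z).im) := by
  have hn0 : n ≠ 0 := by omega
  have H := EpicycloidShear.isHorizontalShear hn
  refine ⟨⟨⟨(EpicycloidShear.differentiable_F n).differentiableOn, EpicycloidShear.injOn_F hn⟩,
    EpicycloidShear.isCHDDomain_image_F hn⟩, ⟨H, fun h g H' => H'.unique H fun z hz h1 => ?_⟩,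
    ⟨EpicycloidShear.f_mem_SH0 hn, H.isCHDDomain_image_harmonicMap
      (fun _ => EpicycloidShear.norm_pow_lt_one hn0) (EpicycloidShear.injOn_F hn)
      (EpicycloidShear.isCHDDomain_image_F hn)⟩, ?_⟩
  · exact EpicycloidShear.one_sub_ne_zero_of_norm_lt_one
      (EpicycloidShear.norm_pow_lt_one hn0 hz) (sub_eq_zero.2 h1.symm)
  · rintro m rfl
    have hm : m ≠ 0 := by omega
    refine ⟨EpicycloidShear.liftsToMinimalGraph_f hm, fun z hz => ?_⟩
    rw [EpicycloidShear.integral_pow_mul_deriv_h hm hz, EpicycloidShear.x₃_eq]
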